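/- Let $d\ge 2$ be an integer. The problem $$\frac1{r^{d-1}}\,|f'|^{d-1}f''-f+|f|^{d-1}f=0,\qquad f'(r)\le 0\quad\text{for } r>0;\qquad f'(0)=f(+\infty)=0,$$ has a nontrivial, nonincreasing, nonnegative, compactly supported solution $F_0:[0,\infty)\to[0,\infty)$ with $F_0(0)>1$. Here a solution is a function in $C^1([0,\infty))$ for which $|f'|^{d-1}f'$ is differentiable on $(0,\infty)$ and the equation holds in the divergence form $\frac{1}{d\,r^{d-1}}\big(|f'|^{d-1}f'\big)'-f+|f|^{d-1}f=0$ at every $r>0$. The support of $F_0$ is an interval $[0,L_S]$ with $0<L_S<\infty$; on $(0,L_S)$ the function $F_0$ is $C^2$ and satisfies the equation classically; and near the interface, as $z\to L_S$, $$F_0(z)=A\,(L_S-z)_+^{\frac{d+1}{d-1}}(1+o(1)),\qquad A=L_S\left[\frac{(d-1)^{d+1}}{2(d+1)^d}\right]^{\frac1{d-1}}.$$ Moreover, for every $T\in\mathbb R$ the function $$u(r,t)=\big[(d-1)(T-t)\big]^{-\frac1{d-1}}F_0(r),\qquad r\ge 0,\ t<T$$ (that is, $u=F_0(r)/(T-t)$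 if $d=2$), is $C^1$ and nonincreasing in $r$ with $u_r(0,t)=0$, and solves $$u_t=\frac1{r^{d-1}}\,|u_r|^{d-1}u_{rr}+|u|^{d-1}u\qquad (r>0,\ t<T),$$ with the spatial operator again taken in the divergence form $\frac{1}{d\,r^{d-1}}\big(|u_r|^{d-1}u_r\big)_r$. This is the form that the parabolic Monge–Ampère equation $u_t=(-1)^{d-1}\det D^2u+|u|^{d-1}u$ in $\mathbb R^d$ takes for radial functions with $u_r\le 0$. Its blow-up is regional: the set of $r\ge0$ for which there are $r_n\to r$ with $r_n\ge 0$, and $t_n\to T$ with $t_n<T$, such that $|u(r_n,t_n)|\to\infty$, is exactly $[0,L_S]$. -/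

import Mathlib

open Set Filter Topology

/-- The radial Monge-Ampère operator `(1 / r^(d-1)) |f'|^(d-1) f''` has the value `m` at the
radius `r`, in divergence form: since formally `(|f'|^(d-1) f')' = d |f'|^(d-1) f''`, this says that
the flux `|f'|^(d-1) f'` is differentiable at `r` and that `(1 / (d r^(d-1))) (|f'|^(d-1) f')' = m`.
(It is used for `r > 0` only.) -/
def HasRadialMA (d : ℕ) (f : ℝ → ℝ) (r m : ℝ) : Prop :=
  HasDerivAt (fun s => |deriv f s| ^ (d - 1) * deriv f s) ((d : ℝ) * r ^ (d - 1) * m) r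

/-- `f`, regarded as a function on `[0, ∞)`, is a monotone solution of the profile problem
`(1 / r^(d-1)) |f'|^(d-1) f'' - f + |f|^(d-1) f = 0` and `f' ≤ 0` for `r > 0`,
`f'(0) = f(+∞) = 0`. The equation is degenerate where `f' = 0`, so a solution is a `C¹` function
on `[0, ∞)` which satisfies it in divergence form. -/
structure IsRadialProfile (d : ℕ) (f : ℝ → ℝ) : Prop where
  contDiffOn : ContDiffOn ℝ 1 f (Ici 0)
  equation : ∀ r, 0 < r → HasRadialMA d f r (f r - |f r| ^ (d - 1) * f r)
  deriv_nonpos : ∀ r, 0 < r → deriv f r ≤ 0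
  deriv_zero : derivWithin f (Ici 0) 0 = 0
  tendsto_zero : Tendsto f atTop (𝓝 0)

/-- `u r t`, for `r ≥ 0` and `t < T`, is a radial solution, nonincreasing in `r`, of the parabolic
Monge-Ampère equation `u_t = (-1)^(d-1) |D² u| + |u|^(d-1) u` in `ℝ^d`, that is, of
`u_t = (1 / r^(d-1)) |u_r|^(d-1) u_rr + |u|^(d-1) u` for `r > 0`, with `u_r = 0` at `r = 0`. (For
`u_r ≤ 0` one has `(-1)^(d-1) (u_r)^(d-1) = |u_r|^(d-1)`.) The spatial operator is taken
in divergence form. -/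
structure IsRadialMAFlow (d : ℕ) (T : ℝ) (u : ℝ → ℝ → ℝ) : Prop where
  contDiffOn : ContDiffOn ℝ 1 (Function.uncurry u) (Ici 0 ×ˢ Iio T)
  equation : ∀ r t, 0 < r → t < T → ∃ m : ℝ, HasRadialMA d (fun s => u s t) r m ∧
    HasDerivAt (fun τ => u r τ) (m + |u r t| ^ (d - 1) * u r t) t
  deriv_nonpos : ∀ r t, 0 < r → t < T → deriv (fun s => u s t) r ≤ 0
  deriv_zero : ∀ t, t < T → derivWithin (fun s => u s t) (Ici 0) 0 = 0

/-- The set of the radii `r ≥ 0` at which `u` blows up as `t → T⁻`: those `r` for which `u` is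
unbounded near `(r, T)`, i.e. `|u rₙ tₙ| → ∞` along some `rₙ → r`, `rₙ ≥ 0`, `tₙ → T`, `tₙ < T`. -/
def radialBlowUpSet (T : ℝ) (u : ℝ → ℝ → ℝ) : Set ℝ :=
  {r | 0 ≤ r ∧ ∀ M : ℝ, ∃ᶠ q in 𝓝[Ici 0 ×ˢ Iio T] ((r, T) : ℝ × ℝ), M < |u q.1 q.2|}

/-! Put `k = d - 1`, `η = 1 / F(0)` and `φ = η F`, and let `w` be the flux `|φ'|^(k+1)`. The profile
equation becomes the first order system `φ' = -w^(1/(k+1))`, `w' = (k+1) r^k (φ^(k+1) - η^k φ)` with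
data `(1, 0)` at `r = 0`. A compactly supported `C¹` solution is one for which `φ` and `w` reach
zero at the same radius, since it can then be continued by zero. So `η` is found by shooting.

The right-hand side is not Lipschitz at `w = 0`, where every shot starts and ends. Hence `w` is
first replaced by `max w δ` in the slope. Then `φ` decreases strictly and vanishes at some `R`, and
everything depends continuously on `η`. For small `η` the source can hardly lower the flux before
`φ` vanishes, so `w R ≥ 0` (`exists_forall_snd_nonneg`). For `η^k = 2/(k+2)` the potential vanishes
at `1`, and an energy with the weight `r^k` frozen at the radius where `φ = η` gives `w R ≤ 0`
(`snd_nonpos`). In between some `η` has `w R = 0` (`exists_regularizedShot_snd_eq_zero`).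

For such shots `R` is bounded independently of `δ`: past the radius where `φ = η`, the energy gives
`|φ'|^(k+2) ≥ b φ²`, so `φ` is extinguished in finite length (`exists_forall_le`). The components
are then equi-Lipschitz, and Arzelà–Ascoli with `δ → 0` yields a solution of the integrated
degenerate system (`exists_integral_profile`). Cutting it at the first zero of `φ` and dividing by
`η` gives the profile (`exists_compactProfile`).

The interface law follows from two applications of l'Hôpital's rule, first to `g^(k+2) / F²` with `g
= -F'`, then to `F^(k/(k+2)) / (L - r)`. The separable flow works because the operator is
homogeneous of degree `k + 1` and the amplitude solves `c' = c^(k+1)`. Blow-up is regional because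
the amplitude multiplies a fixed profile. -/

/-! ### Source, potential and regularised slope -/

/-- The reaction term of the normalised profile equation, with zero `η`. -/
def profileSource (k : ℕ) (η x : ℝ) : ℝ := x ^ (k + 1) - η ^ k * x

/-- The primitive of `profileSource`. -/
noncomputable def profilePotential (k : ℕ) (η x : ℝ) : ℝ :=
  x ^ (k + 2) / ((k : ℝ) + 2) - η ^ k * x ^ 2 / 2

/-- The slope belonging to the flux `w`, kept away from zero by the regularisation `δ`. -/
noncomputable def regSlope (k : ℕ) (δ w : ℝ) : ℝ := (max w δ) ^ (1 / ((k : ℝ) + 1))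

section Source

variable {k : ℕ} {η x y : ℝ}

theorem profileSource_eq : profileSource k η x = x * (x ^ k - η ^ k) := by
  unfold profileSource; ring

theorem profileSource_nonneg (hη : 0 ≤ η) (h : η ≤ x) : 0 ≤ profileSource k η x := by
  rw [profileSource_eq]
  exact mul_nonneg (hη.trans h) (sub_nonneg.2 (pow_le_pow_left₀ hη h k))

theorem profileSource_nonpos (hx : 0 ≤ x) (h : x ≤ η) : profileSource k η x ≤ 0 := by
  rw [profileSource_eq]
  exact mul_nonpos_of_nonneg_of_nonpos hx (sub_nonpos.2 (pow_le_pow_left₀ hx h k))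

theorem profileSource_pos (hk : k ≠ 0) (hη : 0 ≤ η) (h : η < x) : 0 < profileSource k η x := by
  rw [profileSource_eq]
  exact mul_pos (hη.trans_lt h) (sub_pos.2 (pow_lt_pow_left₀ h hη hk))

theorem profileSource_neg (hk : k ≠ 0) (hx : 0 < x) (h : x < η) : profileSource k η x < 0 := by
  rw [profileSource_eq]
  exact mul_neg_of_pos_of_neg hx (sub_neg.2 (pow_lt_pow_left₀ h hx.le hk))

theorem profileSource_le_one (hη : 0 ≤ η) (hx : 0 ≤ x) (hx1 : x ≤ 1) :
    profileSource k η x ≤ 1 := by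
  unfold profileSource
  have h1 := pow_le_one₀ (n := k + 1) hx hx1
  have h2 : 0 ≤ η ^ k * x := by positivity
  linarith

theorem neg_pow_le_profileSource (hη : 0 ≤ η) (hx : 0 ≤ x) (hx1 : x ≤ 1) :
    -η ^ k ≤ profileSource k η x := by
  unfold profileSource
  have h1 : 0 ≤ x ^ (k + 1) := by positivity
  have h2 : η ^ k * x ≤ η ^ k * 1 := by gcongr
  linarith

theorem profileSource_mono (hη : 0 ≤ η) (hy : η ≤ y) (h : y ≤ x) :
    profileSource k η y ≤ profileSource k η x := by
  rw [profileSource_eq, profileSource_eq]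
  have h1 : y ^ k ≤ x ^ k := pow_le_pow_left₀ (hη.trans hy) h k
  have h2 : η ^ k ≤ y ^ k := pow_le_pow_left₀ hη hy k
  exact mul_le_mul h (by linarith) (by linarith) (by linarith)

theorem continuous_profileSource : Continuous (profileSource k η) := by
  unfold profileSource; fun_prop

theorem hasDerivAt_profilePotential :
    HasDerivAt (profilePotential k η) (profileSource k η x) x := by
  unfold profilePotential profileSource
  have h1 := ((hasDerivAt_pow (k + 2) x).div_const ((k : ℝ) + 2)).sub
    (((hasDerivAt_pow 2 x).const_mul (η ^ k)).div_const 2)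
  refine h1.congr_deriv ?_
  have : (k : ℝ) + 2 ≠ 0 := by positivity
  push_cast
  field_simp

theorem profilePotential_zero : profilePotential k η 0 = 0 := by
  simp [profilePotential]

end Source

section Slope

variable {k : ℕ} {δ w a : ℝ}

theorem regSlope_pos (hδ : 0 < δ) : 0 < regSlope k δ w :=
  Real.rpow_pos_of_pos (lt_max_of_lt_right hδ) _

theorem regSlope_pow (hδ : 0 < δ) : regSlope k δ w ^ (k + 1) = max w δ := by
  unfold regSlope
  rw [← Real.rpow_natCast, ← Real.rpow_mul (lt_max_of_lt_right hδ).le]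
  have : (k : ℝ) + 1 ≠ 0 := by positivity
  push_cast
  rw [one_div_mul_cancel this, Real.rpow_one]

theorem regSlope_mono (hδ : 0 < δ) : Monotone (regSlope k δ) := fun x y h =>
  Real.rpow_le_rpow (lt_max_of_lt_right hδ).le (max_le_max_right _ h) (by positivity)

theorem continuous_regSlope : Continuous (regSlope k δ) := by
  unfold regSlope
  exact (continuous_id.max continuous_const).rpow_const fun _ => Or.inr (by positivity)

theorem rpow_le_regSlope (ha : 0 ≤ a) (h : a ≤ w) : a ^ (1 / ((k : ℝ) + 1)) ≤ regSlope k δ w :=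
  Real.rpow_le_rpow ha (h.trans (le_max_left _ _)) (by positivity)

theorem regSlope_le_one (hδ : 0 < δ) (hδ1 : δ ≤ 1) (h : w ≤ 1) : regSlope k δ w ≤ 1 :=
  Real.rpow_le_one (lt_max_of_lt_right hδ).le (max_le h hδ1) (by positivity)

end Slope

/-! ### A priori estimates for the regularised system -/

/-- A solution of the regularised profile system on `[0, R]` which starts from `(1, 0)` and whose
first component vanishes at `R`. -/
structure RegularizedShot (k : ℕ) (η δ R : ℝ) (φ w : ℝ → ℝ) : Prop where
  pos : 0 < R
  cont_fst : ContinuousOn φ (Icc 0 R)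
  cont_snd : ContinuousOn w (Icc 0 R)
  fst_zero : φ 0 = 1
  snd_zero : w 0 = 0
  fst_end : φ R = 0
  deriv_fst : ∀ r ∈ Ioo 0 R, HasDerivAt φ (-regSlope k δ (w r)) r
  deriv_snd : ∀ r ∈ Ioo 0 R, HasDerivAt w ((k + 1) * r ^ k * profileSource k η (φ r)) r

theorem antitoneOn_Icc_of_hasDerivAt {f f' : ℝ → ℝ} {a b : ℝ} (hc : ContinuousOn f (Icc a b))
    (hd : ∀ x ∈ Ioo a b, HasDerivAt f (f' x) x) (hn : ∀ x ∈ Ioo a b, f' x ≤ 0) :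
    AntitoneOn f (Icc a b) :=
  antitoneOn_of_hasDerivWithinAt_nonpos (convex_Icc a b) hc
    (fun x hx => (hd x (by simpa using hx)).hasDerivWithinAt) (fun x hx => hn x (by simpa using hx))

theorem monotoneOn_Icc_of_hasDerivAt {f f' : ℝ → ℝ} {a b : ℝ} (hc : ContinuousOn f (Icc a b))
    (hd : ∀ x ∈ Ioo a b, HasDerivAt f (f' x) x) (hn : ∀ x ∈ Ioo a b, 0 ≤ f' x) :
    MonotoneOn f (Icc a b) :=
  monotoneOn_of_hasDerivWithinAt_nonneg (convex_Icc a b) hc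
    (fun x hx => (hd x (by simpa using hx)).hasDerivWithinAt) (fun x hx => hn x (by simpa using hx))

theorem strictAntiOn_Icc_of_hasDerivAt {f f' : ℝ → ℝ} {a b : ℝ} (hc : ContinuousOn f (Icc a b))
    (hd : ∀ x ∈ Ioo a b, HasDerivAt f (f' x) x) (hn : ∀ x ∈ Ioo a b, f' x < 0) :
    StrictAntiOn f (Icc a b) :=
  strictAntiOn_of_hasDerivWithinAt_neg (convex_Icc a b) hc
    (fun x hx => (hd x (by simpa using hx)).hasDerivWithinAt) (fun x hx => hn x (by simpa using hx))

/-- One-sided comparison of two functions through their derivatives. -/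
theorem sub_le_sub_of_hasDerivAt_le {f f' g g' : ℝ → ℝ} {a b : ℝ} (hab : a ≤ b)
    (hf : ContinuousOn f (Icc a b)) (hg : ContinuousOn g (Icc a b))
    (hdf : ∀ x ∈ Ioo a b, HasDerivAt f (f' x) x) (hdg : ∀ x ∈ Ioo a b, HasDerivAt g (g' x) x)
    (h : ∀ x ∈ Ioo a b, f' x ≤ g' x) : f b - f a ≤ g b - g a := by
  have := antitoneOn_Icc_of_hasDerivAt (hf.sub hg) (fun x hx => (hdf x hx).sub (hdg x hx))
    (fun x hx => sub_nonpos.2 (h x hx)) (left_mem_Icc.2 hab) (right_mem_Icc.2 hab) hab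
  simp only [Pi.sub_apply] at this
  linarith

namespace RegularizedShot

variable {k : ℕ} {η δ R : ℝ} {φ w : ℝ → ℝ}

theorem strictAntiOn (h : RegularizedShot k η δ R φ w) (hδ : 0 < δ) :
    StrictAntiOn φ (Icc 0 R) :=
  strictAntiOn_Icc_of_hasDerivAt h.cont_fst h.deriv_fst fun _ _ => neg_neg_of_pos (regSlope_pos hδ)

theorem fst_nonneg (h : RegularizedShot k η δ R φ w) (hδ : 0 < δ) {r : ℝ} (hr : r ∈ Icc 0 R) :
    0 ≤ φ r := by
  rw [← h.fst_end]
  exact (h.strictAntiOn hδ).antitoneOn hr (right_mem_Icc.2 h.pos.le) hr.2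

theorem fst_pos (h : RegularizedShot k η δ R φ w) (hδ : 0 < δ) {r : ℝ} (hr : r ∈ Ico 0 R) :
    0 < φ r := by
  rw [← h.fst_end]
  exact (h.strictAntiOn hδ) ⟨hr.1, hr.2.le⟩ (right_mem_Icc.2 h.pos.le) hr.2

theorem fst_le_one (h : RegularizedShot k η δ R φ w) (hδ : 0 < δ) {r : ℝ} (hr : r ∈ Icc 0 R) :
    φ r ≤ 1 := by
  rw [← h.fst_zero]
  exact (h.strictAntiOn hδ).antitoneOn (left_mem_Icc.2 h.pos.le) hr hr.1

theorem snd_le_pow (h : RegularizedShot k η δ R φ w) (hη : 0 ≤ η) (hδ : 0 < δ) {r : ℝ}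
    (hr : r ∈ Icc 0 R) : w r ≤ r ^ (k + 1) := by
  have := sub_le_sub_of_hasDerivAt_le (f := w) (g := fun r => r ^ (k + 1)) hr.1
    (h.cont_snd.mono (Icc_subset_Icc_right hr.2)) (by fun_prop)
    (fun x hx => h.deriv_snd x ⟨hx.1, hx.2.trans_le hr.2⟩)
    (fun x _ => hasDerivAt_pow (k + 1) x) (fun x hx => by
      have hx' : x ∈ Icc 0 R := ⟨hx.1.le, hx.2.le.trans hr.2⟩
      have h1 := profileSource_le_one (k := k) hη (h.fst_nonneg hδ hx') (h.fst_le_one hδ hx')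
      have h2 : 0 ≤ ((k : ℝ) + 1) * x ^ k := by have := hx.1; positivity
      push_cast
      simpa using mul_le_mul_of_nonneg_left h1 h2)
  simpa [h.snd_zero] using this

/-- On `[0, 1]` the flux is at most `r^(k+1) ≤ 1`, so the slope is at most `1`. The bound involves
neither `η` nor `δ`, and so keeps `φ` away from zero near the origin uniformly in both. -/
theorem one_sub_le_fst (h : RegularizedShot k η δ R φ w) (hη : 0 ≤ η) (hδ : 0 < δ) (hδ1 : δ ≤ 1)
    {r : ℝ} (hr : r ∈ Icc 0 R) (hr1 : r ≤ 1) : 1 - r ≤ φ r := by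
  have := sub_le_sub_of_hasDerivAt_le (f := fun r : ℝ => -r) (g := φ) hr.1 (by fun_prop)
    (h.cont_fst.mono (Icc_subset_Icc_right hr.2)) (fun x _ => (hasDerivAt_id x).neg)
    (fun x hx => h.deriv_fst x ⟨hx.1, hx.2.trans_le hr.2⟩)
    (fun x hx => by
      have hx1 : x ≤ 1 := hx.2.le.trans hr1
      have h1 := h.snd_le_pow hη hδ (r := x) ⟨hx.1.le, hx.2.le.trans hr.2⟩
      exact neg_le_neg (regSlope_le_one hδ hδ1 (h1.trans (pow_le_one₀ hx.1.le hx1))))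
  rw [h.fst_zero] at this
  linarith

theorem one_le (h : RegularizedShot k η δ R φ w) (hη : 0 ≤ η) (hδ : 0 < δ) (hδ1 : δ ≤ 1) :
    1 ≤ R := by
  by_contra! hR
  have := h.one_sub_le_fst hη hδ hδ1 (right_mem_Icc.2 h.pos.le) hR.le
  rw [h.fst_end] at this
  linarith

/-- Growth of the flux near the origin. -/
theorem le_snd (h : RegularizedShot k η δ R φ w) (hη : 0 ≤ η) (hδ : 0 < δ) (hδ1 : δ ≤ 1)
    {m : ℝ} (hm : η ≤ m) (hm1 : m ≤ 1) :
    profileSource k η m * (1 - m) ^ (k + 1) ≤ w (1 - m) := by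
  have hR := h.one_le hη hδ hδ1
  have := sub_le_sub_of_hasDerivAt_le (f := fun r => profileSource k η m * r ^ (k + 1)) (g := w)
    (a := 0) (b := 1 - m) (by linarith) (by fun_prop)
    (h.cont_snd.mono (Icc_subset_Icc_right (by linarith)))
    (fun x _ => (hasDerivAt_pow (k + 1) x).const_mul _)
    (fun x hx => h.deriv_snd x ⟨hx.1, hx.2.trans_le (by linarith)⟩)
    (fun x hx => by
      have h0 := hx.1
      have h3 := hx.2
      have hx' : x ∈ Icc 0 R := ⟨hx.1.le, by linarith⟩
      -- Up to radius `1 - m` one has `φ ≥ m ≥ η`, where the source is increasing in `φ`, so it is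
      -- at least its value at `m`.
      have h1 := h.one_sub_le_fst hη hδ hδ1 hx' (by linarith)
      have h2 := profileSource_mono (k := k) hη hm (show m ≤ φ x by linarith)
      push_cast
      rw [mul_comm]
      gcongr)
  simpa [h.snd_zero] using this

/-- If the flux stays above `a` on `[s, r]`, then `φ` decreases at least linearly there. -/
theorem fst_le_sub (h : RegularizedShot k η δ R φ w) {a s r : ℝ} (ha : 0 ≤ a) (hs : 0 ≤ s)
    (hsr : s ≤ r) (hr : r ≤ R) (hw : ∀ x ∈ Ioo s r, a ≤ w x) :
    φ r ≤ φ s - a ^ (1 / ((k : ℝ) + 1)) * (r - s) := by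
  have := sub_le_sub_of_hasDerivAt_le (f := φ) (g := fun r => -(a ^ (1 / ((k : ℝ) + 1)) * r)) hsr
    (h.cont_fst.mono (Icc_subset_Icc hs hr)) (by fun_prop)
    (fun x hx => h.deriv_fst x ⟨hs.trans_lt hx.1, hx.2.trans_le hr⟩)
    (fun x _ => ((hasDerivAt_id x).const_mul _).neg) (fun x hx => by
      simpa using rpow_le_regSlope ha (hw x hx))
  linarith

/-- If the zero `η` of the source is small enough, the flux is still nonnegative when `φ`
vanishes. -/
theorem exists_forall_snd_nonneg (k : ℕ) (hk : k ≠ 0) : ∃ η₀ : ℝ, 0 < η₀ ∧ η₀ ≤ 1 / 4 ∧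
    ∀ δ R φ w, 0 < δ → δ ≤ 1 → RegularizedShot k η₀ δ R φ w → 0 ≤ w R := by
  -- At `r = 1/2` the flux is at least `2 * c`. Up to radius `C` it loses at most `η^k C^(k+1) ≤ c`
  -- and stays above `c`, so `φ` falls at rate at least `e`. As `C - 1/2 = 1/e`, `φ` vanishes by
  -- radius `C`, with the flux still at least `c`.
  set c : ℝ := (1 / 2) ^ (2 * k + 4) with hc
  have hc0 : 0 < c := by positivity
  set e : ℝ := c ^ (1 / ((k : ℝ) + 1)) with he
  have he0 : 0 < e := by positivity
  set C : ℝ := 1 / 2 + 1 / e with hC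
  have hC0 : 0 < C := by positivity
  set η : ℝ := min (1 / 4) (c / C ^ (k + 1)) with hη
  have hη0 : 0 < η := by positivity
  have hη4 : η ≤ 1 / 4 := min_le_left _ _
  refine ⟨η, hη0, hη4, fun δ R φ w hδ hδ1 h => ?_⟩
  have hR := h.one_le hη0.le hδ hδ1
  have hηk : η ^ k * C ^ (k + 1) ≤ c := by
    have h1 : η ^ k ≤ η := pow_le_of_le_one hη0.le (by linarith) hk
    calc η ^ k * C ^ (k + 1) ≤ c / C ^ (k + 1) * C ^ (k + 1) := by
          gcongr; exact h1.trans (min_le_right _ _)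
      _ = c := by field_simp
  have hhalf : 2 * c ≤ w (1 / 2) := by
    have h1 := h.le_snd hη0.le hδ hδ1 (m := 1 / 2) (by linarith) (by norm_num)
    rw [show (1 : ℝ) - 1 / 2 = 1 / 2 by norm_num] at h1
    have h2 : (1 / 2 : ℝ) ^ (k + 2) ≤ profileSource k η (1 / 2) := by
      rw [profileSource_eq]
      have h3 : η ^ k ≤ (1 / 4) ^ k := pow_le_pow_left₀ hη0.le hη4 k
      have h4 : (1 / 4 : ℝ) ^ k = (1 / 2) ^ k * (1 / 2) ^ k := by rw [← mul_pow]; norm_num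
      have h5 : (1 / 2 : ℝ) ^ k ≤ 1 / 2 := pow_le_of_le_one (by norm_num) (by norm_num) hk
      have h6 : (0 : ℝ) < (1 / 2) ^ k := by positivity
      have h7 : (1 / 2 : ℝ) ^ (k + 2) = (1 / 2) ^ k / 4 := by rw [pow_add]; ring
      rw [h7]
      nlinarith
    have h3 : 2 * c = (1 / 2 : ℝ) ^ (k + 2) * (1 / 2) ^ (k + 1) := by
      rw [hc, ← pow_add]
      rw [show 2 * k + 4 = (k + 2 + (k + 1)) + 1 by ring, pow_succ]
      ring
    rw [h3]
    exact le_trans (by gcongr) h1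
  have hlow : ∀ r ∈ Icc (1 / 2) R, r ≤ C → c ≤ w r := by
    intro r hr hrC
    have := sub_le_sub_of_hasDerivAt_le (f := fun r => -(η ^ k * r ^ (k + 1))) (g := w)
      hr.1 (by fun_prop) (h.cont_snd.mono (Icc_subset_Icc (by norm_num) hr.2))
      (fun x _ => ((hasDerivAt_pow (k + 1) x).const_mul _).neg)
      (fun x hx => h.deriv_snd x ⟨by linarith [hx.1], hx.2.trans_le hr.2⟩)
      (fun x hx => by
        have hx0 : 0 < x := by linarith [hx.1]
        have hx' : x ∈ Icc 0 R := ⟨hx0.le, hx.2.le.trans hr.2⟩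
        have h1 := neg_pow_le_profileSource (k := k) hη0.le (h.fst_nonneg hδ hx')
          (h.fst_le_one hδ hx')
        push_cast
        have h2 : 0 ≤ ((k : ℝ) + 1) * x ^ k := by positivity
        nlinarith [mul_le_mul_of_nonneg_left h1 h2])
    have hr0 : 0 ≤ r := by linarith [hr.1]
    have h1 : η ^ k * r ^ (k + 1) ≤ η ^ k * C ^ (k + 1) := by gcongr
    have h2 : 0 ≤ η ^ k * (1 / 2) ^ (k + 1) := by positivity
    linarith
  have hRC : R ≤ C := by
    by_contra! hlt
    have h12 : (1 / 2 : ℝ) ≤ C := by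
      have : 0 < 1 / e := by positivity
      linarith
    have h1 := h.fst_le_sub hc0.le (s := 1 / 2) (r := C) (by norm_num) h12 hlt.le
      (fun x hx => hlow x ⟨hx.1.le, hx.2.le.trans hlt.le⟩ hx.2.le)
    have h2 : φ (1 / 2) ≤ 1 := h.fst_le_one hδ ⟨by norm_num, by linarith⟩
    have h3 : 0 < φ C := h.fst_pos hδ ⟨hC0.le, hlt⟩
    have h4 : e * (C - 1 / 2) = 1 := by rw [hC]; field_simp; ring
    rw [← he, h4] at h1
    linarith
  exact hc0.le.trans (hlow R ⟨by linarith, le_rfl⟩ hRC)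

theorem exists_fst_eq (h : RegularizedShot k η δ R φ w) (hη0 : 0 < η) (hη1 : η < 1) :
    ∃ s ∈ Ioo 0 R, φ s = η := by
  obtain ⟨s, hs, hs'⟩ := intermediate_value_Icc' h.pos.le h.cont_fst
    (show η ∈ Icc (φ R) (φ 0) by rw [h.fst_end, h.fst_zero]; exact ⟨hη0.le, hη1.le⟩)
  refine ⟨s, ⟨lt_of_le_of_ne hs.1 ?_, lt_of_le_of_ne hs.2 ?_⟩, hs'⟩
  · rintro rfl; rw [h.fst_zero] at hs'; linarith
  · rintro rfl; rw [h.fst_end] at hs'; linarith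

/-- The energy with frozen weight `s ^ k` is nonincreasing from `a` on. -/
theorem energy_le (h : RegularizedShot k η δ R φ w) (hδ : 0 < δ) {a s : ℝ} (ha : a ∈ Icc 0 R)
    (hs : ∀ r ∈ Ioo a R, r ^ k * profileSource k η (φ r) ≤ s ^ k * profileSource k η (φ r)) :
    ∫ v in (0)..(w R), regSlope k δ v ≤
      (∫ v in (0)..(w a), regSlope k δ v) + (k + 1) * s ^ k * profilePotential k η (φ a) := by
  have hΓ : ∀ x, HasDerivAt (fun x => ∫ v in (0)..x, regSlope k δ v) (regSlope k δ x) x := fun x =>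
    intervalIntegral.integral_hasDerivAt_right (continuous_regSlope.intervalIntegrable _ _)
      continuous_regSlope.aestronglyMeasurable.stronglyMeasurableAtFilter
      continuous_regSlope.continuousAt
  have hΓc : Continuous fun x => ∫ v in (0)..x, regSlope k δ v :=
    continuous_iff_continuousAt.2 fun x => (hΓ x).continuousAt
  have hHc : Continuous (profilePotential k η) :=
    continuous_iff_continuousAt.2 fun x => hasDerivAt_profilePotential.continuousAt
  have hsub : Icc a R ⊆ Icc 0 R := Icc_subset_Icc_left ha.1
  have := antitoneOn_Icc_of_hasDerivAt (a := a) (b := R)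
    (f := fun r => (∫ v in (0)..(w r), regSlope k δ v)
      + (k + 1) * s ^ k * profilePotential k η (φ r))
    ((hΓc.comp_continuousOn (h.cont_snd.mono hsub)).add
      (continuousOn_const.mul (hHc.comp_continuousOn (h.cont_fst.mono hsub))))
    (fun x hx => by
      have hx' : x ∈ Ioo 0 R := ⟨ha.1.trans_lt hx.1, hx.2⟩
      exact ((hΓ (w x)).comp x (h.deriv_snd x hx')).add
        ((hasDerivAt_profilePotential.comp x (h.deriv_fst x hx')).const_mul _))
    (fun x hx => by
      have h1 := mul_le_mul_of_nonneg_left (hs x hx)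
        (mul_nonneg (regSlope_pos (k := k) (w := w x) hδ).le
          (show (0 : ℝ) ≤ (k : ℝ) + 1 by positivity))
      linarith)
    (left_mem_Icc.2 ha.2) (right_mem_Icc.2 ha.2) ha.2
  simpa [h.fst_end, profilePotential_zero] using this

theorem source_nonneg_of_le (h : RegularizedShot k η δ R φ w) (hη : 0 ≤ η) (hδ : 0 < δ) {s r : ℝ}
    (hs : s ∈ Icc 0 R) (hφ : φ s = η) (hr : 0 ≤ r) (hrs : r ≤ s) :
    0 ≤ profileSource k η (φ r) :=
  profileSource_nonneg hη
    (hφ ▸ (h.strictAntiOn hδ).antitoneOn ⟨hr, hrs.trans hs.2⟩ hs hrs)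

theorem source_nonpos_of_le (h : RegularizedShot k η δ R φ w) (hδ : 0 < δ) {s r : ℝ}
    (hs : s ∈ Icc 0 R) (hφ : φ s = η) (hrs : s ≤ r) (hr : r ≤ R) :
    profileSource k η (φ r) ≤ 0 :=
  profileSource_nonpos (h.fst_nonneg hδ ⟨hs.1.trans hrs, hr⟩)
    (hφ ▸ (h.strictAntiOn hδ).antitoneOn hs ⟨hs.1.trans hrs, hr⟩ hrs)

/-- At the value of `η` for which the potential vanishes at `1`, the flux is nonpositive when `φ`
vanishes. -/
theorem snd_nonpos (h : RegularizedShot k η δ R φ w) (hη0 : 0 < η) (hη1 : η < 1) (hδ : 0 < δ)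
    (hη : η ^ k = 2 / ((k : ℝ) + 2)) : w R ≤ 0 := by
  obtain ⟨s, hs, hφ⟩ := h.exists_fst_eq hη0 hη1
  have hs' : s ∈ Icc 0 R := Ioo_subset_Icc_self hs
  -- Freezing the weight where `φ = η` makes the energy decrease on both sides: the source is
  -- nonnegative where `r^k ≤ s^k` and nonpositive where `r^k ≥ s^k`.
  have h1 := h.energy_le hδ (a := 0) (s := s) (left_mem_Icc.2 h.pos.le) (fun r hr => by
    rcases le_total r s with hrs | hrs
    · have := h.source_nonneg_of_le hη0.le hδ hs' hφ hr.1.le hrs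
      have h2 : r ^ k ≤ s ^ k := pow_le_pow_left₀ hr.1.le hrs k
      exact mul_le_mul_of_nonneg_right h2 this
    · have := h.source_nonpos_of_le hδ hs' hφ hrs hr.2.le
      have h2 : s ^ k ≤ r ^ k := pow_le_pow_left₀ hs.1.le hrs k
      exact mul_le_mul_of_nonpos_right h2 this)
  have h2 : profilePotential k η (φ 0) = 0 := by
    rw [h.fst_zero, profilePotential, hη]
    field_simp
    simp
  rw [h2, h.snd_zero] at h1
  by_contra! hw
  have h3 : 0 < ∫ v in (0)..(w R), regSlope k δ v :=
    intervalIntegral.intervalIntegral_pos_of_pos (continuous_regSlope.intervalIntegrable _ _)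
      (fun v => regSlope_pos hδ) hw
  simp at h1
  linarith

/-- The energy inequality on the part of the interval where the source is nonpositive bounds the
slope from below by a power of `φ`. -/
theorem sq_le_regSlope_pow (h : RegularizedShot k η δ R φ w) (hk : k ≠ 0) (hη0 : 0 < η)
    (hδ : 0 < δ) (hw : w R = 0) {s r : ℝ} (hs : s ∈ Icc 0 R) (hφ : φ s = η) (hsr : s ≤ r)
    (hr : r ≤ R) : s ^ k * η ^ k / 6 * φ r ^ 2 ≤ regSlope k δ (w r) ^ (k + 2) := by
  have hr' : r ∈ Icc 0 R := ⟨hs.1.trans hsr, hr⟩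
  -- Here the source is nonpositive on all of `[r, R]`, so the weight may be frozen at the left end
  -- `r`.
  have h1 := h.energy_le hδ (a := r) (s := r) hr' (fun x hx =>
    mul_le_mul_of_nonpos_right (pow_le_pow_left₀ hr'.1 hx.1.le k)
      (h.source_nonpos_of_le hδ hs hφ (hsr.trans hx.1.le) hx.2.le))
  have hw0 : 0 ≤ w r := by
    rw [← hw]
    refine antitoneOn_Icc_of_hasDerivAt (a := s) (b := R)
      (h.cont_snd.mono (Icc_subset_Icc_left hs.1))
      (fun x hx => h.deriv_snd x ⟨hs.1.trans_lt hx.1, hx.2⟩) (fun x hx => ?_)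
      ⟨hsr, hr⟩ ⟨hs.2, le_rfl⟩ hr
    have h0 : 0 ≤ x := hs.1.trans hx.1.le
    exact mul_nonpos_of_nonneg_of_nonpos (by positivity)
      (h.source_nonpos_of_le hδ hs hφ hx.1.le hx.2.le)
  have h2 : ∫ v in (0)..(w r), regSlope k δ v ≤ regSlope k δ (w r) ^ (k + 2) := by
    calc ∫ v in (0)..(w r), regSlope k δ v
        ≤ ∫ v in (0)..(w r), regSlope k δ (w r) :=
          intervalIntegral.integral_mono_on hw0 (continuous_regSlope.intervalIntegrable _ _)
            (by simp) (fun v hv => regSlope_mono hδ hv.2)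
      _ = w r * regSlope k δ (w r) := by simp
      _ ≤ max (w r) δ * regSlope k δ (w r) :=
          mul_le_mul_of_nonneg_right (le_max_left _ _) (regSlope_pos hδ).le
      _ = regSlope k δ (w r) ^ (k + 2) := by rw [← regSlope_pow (k := k) hδ, ← pow_succ]
  have hφ0 := h.fst_nonneg hδ hr'
  have hφη : φ r ≤ η := hφ ▸ (h.strictAntiOn hδ).antitoneOn hs hr' hsr
  -- As `φ ≤ η` and `k + 2 ≥ 3`, the negated potential is at least `(1/2 - 1/3) η^k φ²`.
  have h3 : η ^ k / 6 * φ r ^ 2 ≤ -profilePotential k η (φ r) := by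
    have h4 : φ r ^ k ≤ η ^ k := pow_le_pow_left₀ hφ0 hφη k
    have hk1 : (1 : ℝ) ≤ k := by exact_mod_cast Nat.one_le_iff_ne_zero.2 hk
    have h5 : φ r ^ (k + 2) / ((k : ℝ) + 2) ≤ η ^ k * φ r ^ 2 / 3 := by
      rw [pow_add]
      gcongr
      linarith
    unfold profilePotential
    nlinarith
  rw [hw, intervalIntegral.integral_same] at h1
  have h6 : s ^ k * (η ^ k / 6 * φ r ^ 2) ≤ (k + 1) * r ^ k * -profilePotential k η (φ r) := by
    have hk0 : (0 : ℝ) ≤ k := by positivity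
    have h7 : s ^ k ≤ (k + 1) * r ^ k := by
      have h8 : s ^ k ≤ r ^ k := pow_le_pow_left₀ hs.1 hsr k
      have h9 : 0 ≤ r ^ k := pow_nonneg hr'.1 k
      nlinarith
    have hs0 : 0 ≤ s ^ k := pow_nonneg hs.1 k
    exact mul_le_mul h7 h3 (by positivity) (hs0.trans h7)
  calc s ^ k * η ^ k / 6 * φ r ^ 2 = s ^ k * (η ^ k / 6 * φ r ^ 2) := by ring
    _ ≤ _ := h6
    _ ≤ _ := by linarith

/-- The interval of existence of a regularised solution whose two components vanish simultaneously
is bounded independently of the regularisation. -/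
theorem exists_forall_le (k : ℕ) (hk : k ≠ 0) {η₀ η₁ : ℝ} (h0 : 0 < η₀) (h1 : η₁ < 1) :
    ∃ C : ℝ, ∀ η ∈ Icc η₀ η₁, ∀ δ R φ w, 0 < δ → δ ≤ 1 → RegularizedShot k η δ R φ w → w R = 0 →
      R ≤ C := by
  by_cases h01 : η₀ ≤ η₁
  swap
  · exact ⟨0, fun η hη => absurd (hη.1.trans hη.2) h01⟩
  have h10 : 0 < η₁ := h0.trans_le h01
  obtain ⟨m, hm, hm1⟩ := exists_between h1
  have hm0 : 0 < m := h10.trans hm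
  -- The source decreases in `η`, so `a` bounds the flux at radius `1 - m` from below for every `η ≤
  -- η₁`. From there to the radius `s` with `φ s = η` the flux does not decrease, so `φ` falls at
  -- rate at least `e` and `s - (1 - m) ≤ 1 / e`.
  set a := profileSource k η₁ m * (1 - m) ^ (k + 1) with ha
  have ha0 : 0 < a := mul_pos (profileSource_pos hk h10.le hm) (pow_pos (by linarith) _)
  set e : ℝ := a ^ (1 / ((k : ℝ) + 1)) with he
  have he0 : 0 < e := by positivity
  have hk2 : (k : ℝ) + 2 ≠ 0 := by positivity
  have hk0 : (0 : ℝ) < k := by exact_mod_cast Nat.pos_of_ne_zero hk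
  -- A lower bound for the factor `s^k η^k / 6` of the energy estimate, since `s ≥ 1 - η₁` and `η ≥
  -- η₀`.
  set b : ℝ := (1 - η₁) ^ k * η₀ ^ k / 6 with hb
  have hb0 : 0 < b := by have : 0 < 1 - η₁ := by linarith
                         positivity
  set c : ℝ := k / (k + 2) * b ^ (1 / ((k : ℝ) + 2)) with hc
  have hc0 : 0 < c := by positivity
  refine ⟨1 + 1 / e + 1 / c, fun η hη δ R φ w hδ hδ1 h hw => ?_⟩
  have hη0 : 0 < η := h0.trans_le hη.1
  have hη1 : η < 1 := hη.2.trans_lt h1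
  obtain ⟨s, hs, hφ⟩ := h.exists_fst_eq hη0 hη1
  have hs' : s ∈ Icc 0 R := Ioo_subset_Icc_self hs
  have hR := h.one_le hη0.le hδ hδ1
  have hms : 1 - m ≤ s := by
    by_contra! hlt
    have := h.one_sub_le_fst hη0.le hδ hδ1 hs' (by linarith)
    linarith [hη.2]
  have hηs : 1 - η₁ ≤ s := by
    by_contra! hlt
    have := h.one_sub_le_fst hη0.le hδ hδ1 hs' (by linarith)
    linarith [hη.2]
  have hsbound : s ≤ 1 + 1 / e := by
    have hwm : a ≤ w (1 - m) := by
      refine le_trans ?_ (h.le_snd hη0.le hδ hδ1 (hη.2.trans hm.le) hm1.le)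
      have : profileSource k η₁ m ≤ profileSource k η m := by
        have h3 : η ^ k ≤ η₁ ^ k := pow_le_pow_left₀ hη0.le hη.2 k
        unfold profileSource
        nlinarith
      have h4 : 0 ≤ 1 - m := by linarith
      rw [ha]
      gcongr
    have hlow : ∀ x ∈ Ioo (1 - m) s, a ≤ w x := fun x hx => by
      refine hwm.trans (monotoneOn_Icc_of_hasDerivAt (a := 1 - m) (b := s)
        (h.cont_snd.mono (Icc_subset_Icc (by linarith) hs'.2))
        (fun y hy => h.deriv_snd y ⟨by linarith [hy.1], hy.2.trans_le hs'.2⟩) (fun y hy => ?_)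
        ⟨le_rfl, hms⟩ ⟨hx.1.le, hx.2.le⟩ hx.1.le)
      have hy0 : 0 ≤ y := by linarith [hy.1]
      exact mul_nonneg (by positivity) (h.source_nonneg_of_le hη0.le hδ hs' hφ hy0 hy.2.le)
    have h5 := h.fst_le_sub ha0.le (by linarith) hms hs'.2 hlow
    have h6 := h.fst_le_one hδ (r := 1 - m) ⟨by linarith, by linarith⟩
    have h7 : e * (s - (1 - m)) ≤ 1 := by rw [he]; linarith
    have h8 : s - (1 - m) ≤ 1 / e := by rw [le_div_iff₀ he0]; linarith
    linarith
  have hRs : R - s ≤ 1 / c := by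
    -- The slope is at least `b^(1/(k+2)) φ^(2/(k+2))`; the exponent `k/(k+2)` is the one for which
    -- this becomes a constant rate `c` of decrease.
    have h9 := sub_le_sub_of_hasDerivAt_le (f := fun r => φ r ^ ((k : ℝ) / (k + 2)))
      (g := fun r => -(c * r)) (f' := fun r => -regSlope k δ (w r) * ((k : ℝ) / (k + 2)) *
        φ r ^ ((k : ℝ) / (k + 2) - 1)) hs'.2
      ((h.cont_fst.mono (Icc_subset_Icc_left hs'.1)).rpow_const
        fun x hx => Or.inr (by positivity)) (by fun_prop)
      (fun x hx => (h.deriv_fst x ⟨hs'.1.trans_lt hx.1, hx.2⟩).rpow_const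
        (Or.inl (h.fst_pos hδ ⟨hs'.1.trans hx.1.le, hx.2⟩).ne'))
      (fun x _ => ((hasDerivAt_id x).const_mul c).neg) (fun x hx => by
        have hp := h.fst_pos hδ ⟨hs'.1.trans hx.1.le, hx.2⟩
        have hγ := regSlope_pos (k := k) (w := w x) hδ
        have h10 : b * φ x ^ 2 ≤ regSlope k δ (w x) ^ (k + 2) := by
          refine le_trans ?_ (h.sq_le_regSlope_pow hk hη0 hδ hw hs' hφ hx.1.le hx.2.le)
          have h11 : 0 ≤ 1 - η₁ := by linarith
          have h12 := hη.1
          have h18 := pow_nonneg hs'.1 k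
          rw [hb]
          gcongr
        have h13 : b ^ (1 / ((k : ℝ) + 2)) * φ x ^ (2 / ((k : ℝ) + 2)) ≤ regSlope k δ (w x) := by
          have := Real.rpow_le_rpow (by positivity) h10
            (show (0 : ℝ) ≤ 1 / ((k : ℝ) + 2) by positivity)
          rw [Real.mul_rpow hb0.le (by positivity), ← Real.rpow_natCast, ← Real.rpow_natCast,
            ← Real.rpow_mul hp.le, ← Real.rpow_mul hγ.le] at this
          push_cast at this
          rwa [mul_one_div_cancel hk2, Real.rpow_one, mul_one_div] at this
        have h14 : (k : ℝ) / (k + 2) - 1 = -(2 / ((k : ℝ) + 2)) := by field_simp; ring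
        have h15 : b ^ (1 / ((k : ℝ) + 2)) ≤
            regSlope k δ (w x) * φ x ^ ((k : ℝ) / (k + 2) - 1) := by
          rw [h14, Real.rpow_neg hp.le, ← div_eq_mul_inv, le_div_iff₀ (by positivity)]
          exact h13
        have h16 : c ≤ k / (k + 2) * (regSlope k δ (w x) * φ x ^ ((k : ℝ) / (k + 2) - 1)) := by
          rw [hc]; gcongr
        linarith)
    rw [h.fst_end, Real.zero_rpow (by positivity)] at h9
    have h17 : φ s ^ ((k : ℝ) / (k + 2)) ≤ 1 :=
      Real.rpow_le_one (h.fst_nonneg hδ hs') (h.fst_le_one hδ hs') (by positivity)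
    rw [le_div_iff₀ hc0]
    linarith
  linarith

end RegularizedShot

/-! ### Continuous dependence on the parameter and shooting -/

/-- A bounded, globally Lipschitz time-dependent vector field has a continuous flow on every
compact time interval. -/
theorem exists_flow_of_lipschitz_of_bounded {E : Type*} [NormedAddCommGroup E] [NormedSpace ℝ E]
    [CompleteSpace E] {V : ℝ × E → E} {K M : NNReal} (hV : LipschitzWith K V)
    (hM : ∀ p, ‖V p‖ ≤ M) (x₀ : E) {B : ℝ} (hB : 0 ≤ B) :
    ∃ α : E × ℝ → E, (∀ x ∈ Metric.closedBall x₀ 1, α (x, 0) = x ∧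
      ∀ t ∈ Ioo 0 B, HasDerivAt (fun t => α (x, t)) (V (t, α (x, t))) t) ∧
      ContinuousOn α (Metric.closedBall x₀ 1 ×ˢ Icc 0 B) := by
  -- A trajectory moves at most `M * B` from an initial point at distance at most `1` from `x₀`,
  -- hence the radius `M * B + 1`.
  have hpl : IsPicardLindelof (fun t x => V (t, x)) (⟨0, left_mem_Icc.2 hB⟩ : Icc 0 B) x₀
      (M * B.toNNReal + 1) 1 M K :=
    { lipschitzOnWith := fun t _ => by
        have := hV.comp (LipschitzWith.prodMk_left (α := ℝ) (β := E) t)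
        rw [mul_one] at this
        exact this.lipschitzOnWith
      continuousOn := fun x _ => (hV.continuous.comp (by fun_prop)).continuousOn
      norm_le := fun t _ x _ => hM _
      mul_max_le := by simp [hB] }
  obtain ⟨α, hα, hc⟩ := hpl.exists_forall_mem_closedBall_eq_hasDerivWithinAt_continuousOn
  refine ⟨α, fun x hx => ⟨(hα x (by simpa using hx)).1, fun t ht => ?_⟩, by simpa using hc⟩
  exact ((hα x (by simpa using hx)).2 t (Ioo_subset_Icc_self ht)).hasDerivAt
    (Icc_mem_nhds ht.1 ht.2)

/-- A function on a product of reals that is `C¹` on a box becomes globally Lipschitz and bounded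
after clipping its arguments to the box. -/
theorem exists_lipschitz_clip {E : Type*} [NormedAddCommGroup E] [NormedSpace ℝ E]
    {V : ℝ × ℝ × ℝ × ℝ → E} {a₁ b₁ a₂ b₂ a₃ b₃ a₄ b₄ : ℝ} (h₁ : a₁ ≤ b₁) (h₂ : a₂ ≤ b₂)
    (h₃ : a₃ ≤ b₃) (h₄ : a₄ ≤ b₄)
    (hV : ContDiffOn ℝ 1 V (Icc a₁ b₁ ×ˢ Icc a₂ b₂ ×ˢ Icc a₃ b₃ ×ˢ Icc a₄ b₄)) :
    ∃ K M : NNReal, LipschitzWith K (fun p : ℝ × ℝ × ℝ × ℝ =>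
        V (max a₁ (min p.1 b₁), max a₂ (min p.2.1 b₂), max a₃ (min p.2.2.1 b₃),
          max a₄ (min p.2.2.2 b₄))) ∧
      ∀ p : ℝ × ℝ × ℝ × ℝ, ‖V (max a₁ (min p.1 b₁), max a₂ (min p.2.1 b₂),
        max a₃ (min p.2.2.1 b₃), max a₄ (min p.2.2.2 b₄))‖ ≤ M := by
  have hcpt : IsCompact (Icc a₁ b₁ ×ˢ Icc a₂ b₂ ×ˢ Icc a₃ b₃ ×ˢ Icc a₄ b₄) :=
    isCompact_Icc.prod (isCompact_Icc.prod (isCompact_Icc.prod isCompact_Icc))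
  have hcvx : Convex ℝ (Icc a₁ b₁ ×ˢ Icc a₂ b₂ ×ˢ Icc a₃ b₃ ×ˢ Icc a₄ b₄) :=
    (convex_Icc _ _).prod ((convex_Icc _ _).prod ((convex_Icc _ _).prod (convex_Icc _ _)))
  have hmem : ∀ p : ℝ × ℝ × ℝ × ℝ, (max a₁ (min p.1 b₁), max a₂ (min p.2.1 b₂),
      max a₃ (min p.2.2.1 b₃), max a₄ (min p.2.2.2 b₄)) ∈
      Icc a₁ b₁ ×ˢ Icc a₂ b₂ ×ˢ Icc a₃ b₃ ×ˢ Icc a₄ b₄ := fun p => by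
    simp [h₁, h₂, h₃, h₄]
  obtain ⟨K, hK⟩ := hV.exists_lipschitzOnWith one_ne_zero hcvx hcpt
  obtain ⟨M, hM⟩ := hcpt.exists_bound_of_continuousOn hV.continuousOn
  have l1 : LipschitzWith 1 (fun p : ℝ × ℝ × ℝ × ℝ => p.1) := LipschitzWith.prod_fst
  have l2 : LipschitzWith 1 (fun p : ℝ × ℝ × ℝ × ℝ => p.2.1) := by
    simpa using! (LipschitzWith.prod_fst (α := ℝ) (β := ℝ × ℝ)).comp
      (LipschitzWith.prod_snd (α := ℝ) (β := ℝ × ℝ × ℝ))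
  have l22 : LipschitzWith 1 (fun p : ℝ × ℝ × ℝ × ℝ => p.2.2) := by
    simpa using! (LipschitzWith.prod_snd (α := ℝ) (β := ℝ × ℝ)).comp
      (LipschitzWith.prod_snd (α := ℝ) (β := ℝ × ℝ × ℝ))
  have l3 : LipschitzWith 1 (fun p : ℝ × ℝ × ℝ × ℝ => p.2.2.1) := by
    simpa using! (LipschitzWith.prod_fst (α := ℝ) (β := ℝ)).comp l22
  have l4 : LipschitzWith 1 (fun p : ℝ × ℝ × ℝ × ℝ => p.2.2.2) := by
    simpa using! (LipschitzWith.prod_snd (α := ℝ) (β := ℝ)).comp l22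
  have hclip : LipschitzWith 1 (fun p : ℝ × ℝ × ℝ × ℝ => (max a₁ (min p.1 b₁),
      max a₂ (min p.2.1 b₂), max a₃ (min p.2.2.1 b₃), max a₄ (min p.2.2.2 b₄))) := by
    simpa using ((l1.min_const b₁).const_max a₁).prodMk
      (((l2.min_const b₂).const_max a₂).prodMk
        (((l3.min_const b₃).const_max a₃).prodMk ((l4.min_const b₄).const_max a₄)))
  refine ⟨K, M.toNNReal, ?_, fun p => (hM _ (hmem p)).trans (Real.le_coe_toNNReal M)⟩
  have := hK.comp hclip.lipschitzOnWith (s := univ) (fun p _ => hmem p)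
  rw [mul_one, lipschitzOnWith_univ] at this
  exact this

/-- The regularised solutions form a continuous family in the parameter `η`. -/
theorem exists_regularizedShot_family (k : ℕ) {δ : ℝ} (hδ : 0 < δ) :
    ∃ (B : ℝ) (Φ W : ℝ × ℝ → ℝ), ContinuousOn Φ (Icc 0 1 ×ˢ Icc 0 B) ∧
      ContinuousOn W (Icc 0 1 ×ˢ Icc 0 B) ∧ ∀ η ∈ Icc (0 : ℝ) 1,
        (∃ R ∈ Icc 0 B, Φ (η, R) = 0) ∧ ∀ R ∈ Icc 0 B, Φ (η, R) = 0 →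
          RegularizedShot k η δ R (fun r => Φ (η, r)) (fun r => W (η, r)) := by
  set e : ℝ := δ ^ (1 / ((k : ℝ) + 1)) with he
  have he0 : 0 < e := by positivity
  set B : ℝ := 1 / e with hB
  have hB0 : 0 < B := by positivity
  set M : ℝ := B ^ (k + 1) + δ with hM
  have hδM : δ ≤ M := by have : 0 < B ^ (k + 1) := by positivity
                         linarith
  -- The state is `(φ, w, η)`: carrying `η` with zero velocity turns dependence on the parameter
  -- into dependence on initial data. Clipping `w` below at `δ` is the regularisation itself. The
  -- other clippings are inactive until `φ` vanishes: `w ≤ M` because the source is at most `1`, and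
  -- `φ` stays in `[0, 1]`. It vanishes by `B`, since it falls at rate at least `e = 1 / B`.
  set V : ℝ × ℝ × ℝ × ℝ → ℝ × ℝ × ℝ := fun p =>
    (-(p.2.2.1 ^ (1 / ((k : ℝ) + 1))), (k + 1) * p.1 ^ k * (p.2.1 ^ (k + 1) - p.2.2.2 ^ k * p.2.1),
      0) with hV
  have hVd : ContDiffOn ℝ 1 V (Icc 0 B ×ˢ Icc 0 1 ×ˢ Icc δ M ×ˢ Icc 0 1) := by
    refine ContDiffOn.prodMk ?_ (ContDiff.contDiffOn (by fun_prop))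
    refine ContDiffOn.neg (ContDiffOn.rpow_const_of_ne (by fun_prop) fun p hp => ?_)
    exact (hδ.trans_le hp.2.2.1.1).ne'
  obtain ⟨K, M', hLip, hbd⟩ := exists_lipschitz_clip hB0.le zero_le_one hδM zero_le_one hVd
  obtain ⟨α, hα, hαc⟩ := exists_flow_of_lipschitz_of_bounded hLip hbd ((1, 0, 0) : ℝ × ℝ × ℝ) hB0.le
  have hball : ∀ η ∈ Icc (0 : ℝ) 1, ((1, 0, η) : ℝ × ℝ × ℝ) ∈
      Metric.closedBall ((1, 0, 0) : ℝ × ℝ × ℝ) 1 := fun η hη => by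
    simp [Prod.dist_eq, abs_of_nonneg hη.1, hη.2]
  have hmaps : MapsTo (fun p : ℝ × ℝ => (((1, 0, p.1) : ℝ × ℝ × ℝ), p.2)) (Icc 0 1 ×ˢ Icc 0 B)
      (Metric.closedBall ((1, 0, 0) : ℝ × ℝ × ℝ) 1 ×ˢ Icc 0 B) :=
    fun p hp => ⟨hball p.1 hp.1, hp.2⟩
  have hβ : ContinuousOn (fun p : ℝ × ℝ => α ((1, 0, p.1), p.2)) (Icc 0 1 ×ˢ Icc 0 B) :=
    hαc.comp (by fun_prop) hmaps
  refine ⟨B, fun p => (α ((1, 0, p.1), p.2)).1, fun p => (α ((1, 0, p.1), p.2)).2.1,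
    continuous_fst.comp_continuousOn hβ,
    (continuous_fst.comp continuous_snd).comp_continuousOn hβ, fun η hη => ?_⟩
  obtain ⟨h0, hd⟩ := hα _ (hball η hη)
  have hx1 : (α ((1, 0, η), 0)).1 = 1 := by rw [h0]
  have hx2 : (α ((1, 0, η), 0)).2.1 = 0 := by rw [h0]
  have hx3 : (α ((1, 0, η), 0)).2.2 = η := by rw [h0]
  have hxmem := hball η hη
  clear h0
  dsimp only
  generalize ((1, 0, η) : ℝ × ℝ × ℝ) = x at *
  have hc : ContinuousOn (fun r => α (x, r)) (Icc 0 B) :=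
    hαc.comp (by fun_prop) fun r hr => ⟨hxmem, hr⟩
  have hc1 : ContinuousOn (fun r => (α (x, r)).1) (Icc 0 B) := continuous_fst.comp_continuousOn hc
  have hc2 : ContinuousOn (fun r => (α (x, r)).2.1) (Icc 0 B) :=
    (continuous_fst.comp continuous_snd).comp_continuousOn hc
  have hc3 : ContinuousOn (fun r => (α (x, r)).2.2) (Icc 0 B) :=
    (continuous_snd.comp continuous_snd).comp_continuousOn hc
  have hd1 : ∀ r ∈ Ioo 0 B, HasDerivAt (fun r => (α (x, r)).1) _ r := fun r hr =>
    (ContinuousLinearMap.fst ℝ ℝ (ℝ × ℝ)).hasFDerivAt.comp_hasDerivAt r (hd r hr)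
  have hd2 : ∀ r ∈ Ioo 0 B, HasDerivAt (fun r => (α (x, r)).2.1) _ r := fun r hr =>
    ((ContinuousLinearMap.fst ℝ ℝ ℝ).comp
      (ContinuousLinearMap.snd ℝ ℝ (ℝ × ℝ))).hasFDerivAt.comp_hasDerivAt r (hd r hr)
  have hd3 : ∀ r ∈ Ioo 0 B, HasDerivAt (fun r => (α (x, r)).2.2) _ r := fun r hr =>
    ((ContinuousLinearMap.snd ℝ ℝ ℝ).comp
      (ContinuousLinearMap.snd ℝ ℝ (ℝ × ℝ))).hasFDerivAt.comp_hasDerivAt r (hd r hr)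
  have hη' : ∀ r ∈ Icc 0 B, (α (x, r)).2.2 = η := fun r hr => by
    have h1 := sub_le_sub_of_hasDerivAt_le hr.1 (hc3.mono (Icc_subset_Icc_right hr.2))
      (continuousOn_const (c := (0 : ℝ))) (fun y hy => hd3 y ⟨hy.1, hy.2.trans_le hr.2⟩)
      (fun y _ => hasDerivAt_const y 0) (fun y _ => le_rfl)
    have h2 := sub_le_sub_of_hasDerivAt_le hr.1 (continuousOn_const (c := (0 : ℝ)))
      (hc3.mono (Icc_subset_Icc_right hr.2)) (fun y _ => hasDerivAt_const y 0)
      (fun y hy => hd3 y ⟨hy.1, hy.2.trans_le hr.2⟩) (fun y _ => le_rfl)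
    linarith
  have hw : ∀ r ∈ Icc 0 B, (α (x, r)).2.1 ≤ M := fun r hr => by
    have h1 := sub_le_sub_of_hasDerivAt_le (g := fun r => r ^ (k + 1)) hr.1
      (hc2.mono (Icc_subset_Icc_right hr.2)) (by fun_prop)
      (fun y hy => hd2 y ⟨hy.1, hy.2.trans_le hr.2⟩) (fun y _ => hasDerivAt_pow (k + 1) y)
      (fun y hy => by
        have hyB : y ≤ B := hy.2.le.trans hr.2
        have h3 := profileSource_le_one (k := k)
          (η := max 0 (min (α (x, y)).2.2 1)) (x := max 0 (min (α (x, y)).1 1))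
          (le_max_left _ _) (le_max_left _ _) (by simp)
        rw [profileSource] at h3
        have h4 : max 0 (min y B) = y := by rw [min_eq_left hyB, max_eq_right hy.1.le]
        have h5 : 0 ≤ ((k : ℝ) + 1) * y ^ k := by have := hy.1; positivity
        have h6 := mul_le_mul_of_nonneg_left h3 h5
        simp only [hV, h4]
        push_cast
        simpa using h6)
    have h2 : r ^ (k + 1) ≤ B ^ (k + 1) := pow_le_pow_left₀ hr.1 hr.2 _
    rw [hx2, zero_pow (Nat.succ_ne_zero k)] at h1
    linarith
  have hslope : ∀ r ∈ Ioo 0 B, HasDerivAt (fun r => (α (x, r)).1)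
      (-regSlope k δ (α (x, r)).2.1) r := fun r hr => by
    refine (hd1 r hr).congr_deriv ?_
    change -(max δ (min (α (x, r)).2.1 M)) ^ (1 / ((k : ℝ) + 1)) = _
    rw [min_eq_left (hw r (Ioo_subset_Icc_self hr)), max_comm, regSlope]
  have hanti : AntitoneOn (fun r => (α (x, r)).1) (Icc 0 B) :=
    antitoneOn_Icc_of_hasDerivAt hc1 hslope fun _ _ => (neg_neg_of_pos (regSlope_pos hδ)).le
  refine ⟨?_, fun R hR hR0 => ?_⟩
  · have h1 := sub_le_sub_of_hasDerivAt_le (g := fun r => -(e * r)) hB0.le hc1 (by fun_prop) hslope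
      (fun y _ => ((hasDerivAt_id y).const_mul e).neg) (fun y _ => by
        rw [mul_one, neg_le_neg_iff]
        exact Real.rpow_le_rpow hδ.le (le_max_right (α (x, y)).2.1 δ) (by positivity))
    have h2 : e * B = 1 := by rw [hB]; field_simp
    simp only [hx1, h2, mul_zero] at h1
    obtain ⟨R, hR, hR'⟩ := intermediate_value_Icc' hB0.le hc1
      (show (0 : ℝ) ∈ Icc (α (x, B)).1 (α (x, 0)).1 by
        rw [hx1]; exact ⟨by linarith, zero_le_one⟩)
    exact ⟨R, hR, hR'⟩
  · have hR0' : (α (x, R)).1 = 0 := hR0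
    have hRpos : 0 < R := by
      refine lt_of_le_of_ne hR.1 ?_
      rintro rfl
      rw [hx1] at hR0'
      exact one_ne_zero hR0'
    have hsub : Icc 0 R ⊆ Icc 0 B := Icc_subset_Icc_right hR.2
    have hsub' : Ioo 0 R ⊆ Ioo 0 B := Ioo_subset_Ioo_right hR.2
    refine ⟨hRpos, hc1.mono hsub, hc2.mono hsub, hx1, hx2, hR0',
      fun r hr => hslope r (hsub' hr), fun r hr => ?_⟩
    have hr' := hsub' hr
    refine (hd2 r hr').congr_deriv ?_
    have h1 : (α (x, r)).1 ≤ 1 := by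
      have := hanti (left_mem_Icc.2 hB0.le) (Ioo_subset_Icc_self hr') hr'.1.le
      simpa [hx1] using this
    have h2 : 0 ≤ (α (x, r)).1 := by
      rw [← hR0']
      exact hanti (Ioo_subset_Icc_self hr') hR hr.2.le
    simp only [hV, profileSource, hη' r (Ioo_subset_Icc_self hr'), min_eq_left h1,
      max_eq_right h2, min_eq_left hr'.2.le, max_eq_right hr'.1.le, min_eq_left hη.2,
      max_eq_right hη.1]
    rfl

/-- Shooting: between a parameter for which the flux ends up nonnegative and one for which it ends
up nonpositive, there is a parameter for which both components vanish simultaneously. -/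
theorem exists_regularizedShot_snd_eq_zero (k : ℕ) {δ η₀ η₁ : ℝ} (hδ : 0 < δ) (h0 : 0 ≤ η₀)
    (h01 : η₀ ≤ η₁) (h1 : η₁ ≤ 1)
    (hleft : ∀ R φ w, RegularizedShot k η₀ δ R φ w → 0 ≤ w R)
    (hright : ∀ R φ w, RegularizedShot k η₁ δ R φ w → w R ≤ 0) :
    ∃ η ∈ Icc η₀ η₁, ∃ R φ w, RegularizedShot k η δ R φ w ∧ w R = 0 := by
  obtain ⟨B, Φ, W, hΦ, hW, h⟩ := exists_regularizedShot_family k hδ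
  have hsub : Icc η₀ η₁ ⊆ Icc 0 1 := Icc_subset_Icc h0 h1
  have hcpt : IsCompact (Icc η₀ η₁ ×ˢ Icc 0 B) := isCompact_Icc.prod isCompact_Icc
  have hΦ' := hΦ.mono (prod_mono_left (t := Icc 0 B) hsub)
  have hW' := hW.mono (prod_mono_left (t := Icc 0 B) hsub)
  have hZ : IsClosed ((Icc η₀ η₁ ×ˢ Icc 0 B) ∩ Φ ⁻¹' {0}) :=
    hΦ'.preimage_isClosed_of_isClosed hcpt.isClosed isClosed_singleton
  have hproj : ∀ T : Set ℝ, IsClosed T →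
      IsClosed (Prod.fst '' (((Icc η₀ η₁ ×ˢ Icc 0 B) ∩ Φ ⁻¹' {0}) ∩
        ((Icc η₀ η₁ ×ˢ Icc 0 B) ∩ W ⁻¹' T))) := fun T hT =>
    ((hcpt.of_isClosed_subset (hZ.inter (hW'.preimage_isClosed_of_isClosed hcpt.isClosed hT))
      (inter_subset_left.trans inter_subset_left)).image continuous_fst).isClosed
  -- The parameters having a zero of `φ` with `w ≥ 0`, respectively `w ≤ 0`, form two closed
  -- nonempty sets covering a connected interval, so they meet. At a common parameter the two zeros
  -- agree, because `φ` is positive before its zero; no continuity of `R` in `η` is needed.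
  obtain ⟨η, hη, ⟨⟨_, R⟩, ⟨⟨hp, hp0⟩, -, hpw⟩, rfl⟩, ⟨⟨_, R'⟩, ⟨⟨hq, hq0⟩, -, hqw⟩, hpq⟩⟩ :=
    isPreconnected_closed_iff.1 (isPreconnected_Icc (a := η₀) (b := η₁)) _ _
      (hproj _ isClosed_Ici) (hproj _ isClosed_Iic) (fun η hη => by
        obtain ⟨R, hR, hR0⟩ := (h η (hsub hη)).1
        rcases le_total 0 (W (η, R)) with hw | hw
        · exact Or.inl ⟨(η, R), ⟨⟨⟨hη, hR⟩, hR0⟩, ⟨hη, hR⟩, hw⟩, rfl⟩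
        · exact Or.inr ⟨(η, R), ⟨⟨⟨hη, hR⟩, hR0⟩, ⟨hη, hR⟩, hw⟩, rfl⟩)
      (by
        have hη : η₀ ∈ Icc η₀ η₁ := left_mem_Icc.2 h01
        obtain ⟨⟨R, hR, hR0⟩, hs⟩ := h η₀ (hsub hη)
        exact ⟨η₀, hη, ⟨(η₀, R), ⟨⟨⟨hη, hR⟩, hR0⟩, ⟨hη, hR⟩, hleft _ _ _ (hs R hR hR0)⟩, rfl⟩⟩)
      (by
        have hη : η₁ ∈ Icc η₀ η₁ := right_mem_Icc.2 h01
        obtain ⟨⟨R, hR, hR0⟩, hs⟩ := h η₁ (hsub hη)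
        exact ⟨η₁, hη, ⟨(η₁, R), ⟨⟨⟨hη, hR⟩, hR0⟩, ⟨hη, hR⟩, hright _ _ _ (hs R hR hR0)⟩, rfl⟩⟩)
  simp only at hpq
  subst hpq
  have hs := (h _ (hsub hp.1)).2 R hp.2 hp0
  have hs' := (h _ (hsub hp.1)).2 R' hq.2 hq0
  have hRR : R = R' := by
    rcases lt_trichotomy R R' with hlt | heq | hlt
    · exact absurd hp0 (hs'.fst_pos hδ ⟨hs.pos.le, hlt⟩).ne'
    · exact heq
    · exact absurd hq0 (hs.fst_pos hδ ⟨hs'.pos.le, hlt⟩).ne'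
  subst hRR
  exact ⟨_, hp.1, R, _, _, hs, le_antisymm hqw hpw⟩

/-! ### Compactness and removal of the regularisation -/

/-- **Arzelà–Ascoli** for uniformly Lipschitz functions with values in a compact set. -/
theorem exists_subseq_tendsto_of_lipschitzWith {E : Type*} [MetricSpace E] {f : ℕ → ℝ → E}
    {K : NNReal} {s : Set E} {C : ℝ} (hC : 0 ≤ C) (hs : IsCompact s)
    (hf : ∀ n, LipschitzWith K (f n)) (hfs : ∀ n x, f n x ∈ s) :
    ∃ ψ : ℕ → ℕ, StrictMono ψ ∧ ∃ g : ℝ → E, Continuous g ∧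
      ∀ x ∈ Icc 0 C, Tendsto (fun n => f (ψ n) x) atTop (𝓝 (g x)) := by
  let F : ℕ → BoundedContinuousFunction (Icc (0 : ℝ) C) E := fun n =>
    BoundedContinuousFunction.mkOfCompact
      ⟨fun x => f n x, (hf n).continuous.comp continuous_subtype_val⟩
  have hcpt : IsCompact (closure (range F)) := by
    refine BoundedContinuousFunction.arzela_ascoli s hs _ ?_ ?_
    · rintro _ x ⟨n, rfl⟩
      exact hfs n x
    · refine (LipschitzWith.uniformEquicontinuous _ K ?_).equicontinuous
      rintro ⟨_, n, rfl⟩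
      have := (hf n).comp (LipschitzWith.subtype_val (Icc (0 : ℝ) C))
      rw [mul_one] at this
      exact this
  obtain ⟨G, -, ψ, hψ, hG⟩ := hcpt.tendsto_subseq (x := F) fun n => subset_closure ⟨n, rfl⟩
  refine ⟨ψ, hψ, fun x => G (projIcc 0 C hC x), G.continuous.comp continuous_projIcc,
    fun x hx => ?_⟩
  have h1 := (BoundedContinuousFunction.tendsto_iff_tendstoUniformly.1 hG).tendsto_at
    (projIcc 0 C hC x)
  simp only [projIcc_of_mem hC hx] at h1 ⊢
  exact h1

theorem lipschitzOnWith_Icc_of_hasDerivAt {f f' : ℝ → ℝ} {a b : ℝ} {K : NNReal}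
    (hc : ContinuousOn f (Icc a b)) (hd : ∀ x ∈ Ioo a b, HasDerivAt f (f' x) x)
    (hK : ∀ x ∈ Ioo a b, |f' x| ≤ K) : LipschitzOnWith K f (Icc a b) := by
  have key : ∀ x ∈ Icc a b, ∀ y ∈ Icc a b, x ≤ y → |f x - f y| ≤ K * |x - y| := by
    intro x hx y hy hxy
    have h1 := sub_le_sub_of_hasDerivAt_le (g := fun z => K * z) hxy
      (hc.mono (Icc_subset_Icc hx.1 hy.2)) (by fun_prop)
      (fun z hz => hd z ⟨hx.1.trans_lt hz.1, hz.2.trans_le hy.2⟩)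
      (fun z _ => (hasDerivAt_id z).const_mul _)
      (fun z hz => by
        simpa using (abs_le.1 (hK z ⟨hx.1.trans_lt hz.1, hz.2.trans_le hy.2⟩)).2)
    have h2 := sub_le_sub_of_hasDerivAt_le (f := fun z => -(K * z)) hxy (by fun_prop)
      (hc.mono (Icc_subset_Icc hx.1 hy.2)) (fun z _ => ((hasDerivAt_id z).const_mul _).neg)
      (fun z hz => hd z ⟨hx.1.trans_lt hz.1, hz.2.trans_le hy.2⟩)
      (fun z hz => by
        simpa using (abs_le.1 (hK z ⟨hx.1.trans_lt hz.1, hz.2.trans_le hy.2⟩)).1)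
    rw [abs_sub_comm x y, abs_of_nonneg (sub_nonneg.2 hxy), abs_le]
    constructor <;> linarith
  refine LipschitzOnWith.of_dist_le_mul fun x hx y hy => ?_
  rw [Real.dist_eq, Real.dist_eq]
  rcases le_total x y with h | h
  · exact key x hx y hy h
  · rw [abs_sub_comm, abs_sub_comm x y]
    exact key y hy x hx h

theorem lipschitzWith_clip (a b : ℝ) : LipschitzWith 1 fun x : ℝ => max a (min x b) :=
  (LipschitzWith.id.min_const b).const_max a

theorem clip_mem {a b : ℝ} (h : a ≤ b) (x : ℝ) : max a (min x b) ∈ Icc a b := by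
  simp [h]

theorem clip_of_mem {a b x : ℝ} (h : x ∈ Icc a b) : max a (min x b) = x := by
  rw [min_eq_left h.2, max_eq_right h.1]

theorem LipschitzOnWith.comp_clip {f : ℝ → ℝ} {a b : ℝ} {K : NNReal} (hab : a ≤ b)
    (h : LipschitzOnWith K f (Icc a b)) : LipschitzWith K fun x => f (max a (min x b)) := by
  have := h.comp ((lipschitzWith_clip a b).lipschitzOnWith (s := univ)) fun x _ => clip_mem hab x
  rw [mul_one, lipschitzOnWith_univ] at this
  exact this

namespace RegularizedShot

variable {k : ℕ} {η δ R : ℝ} {φ w : ℝ → ℝ}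

theorem abs_source_le_one (h : RegularizedShot k η δ R φ w) (hη : 0 ≤ η) (hη1 : η ≤ 1)
    (hδ : 0 < δ) {r : ℝ} (hr : r ∈ Icc 0 R) : |profileSource k η (φ r)| ≤ 1 := by
  have h0 := h.fst_nonneg hδ hr
  have h1 := h.fst_le_one hδ hr
  have h2 := neg_pow_le_profileSource (k := k) hη h0 h1
  have h3 : η ^ k ≤ 1 := pow_le_one₀ hη hη1
  exact abs_le.2 ⟨by linarith, profileSource_le_one hη h0 h1⟩

/-- The bound is independent of `δ`; with `abs_deriv_snd_le` it provides the common Lipschitz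
constant needed for compactness. -/
theorem regSlope_le (h : RegularizedShot k η δ R φ w) (hη : 0 ≤ η) (hδ : 0 < δ) (hδ1 : δ ≤ 1)
    {C r : ℝ} (hC : R ≤ C) (hr : r ∈ Icc 0 R) : regSlope k δ (w r) ≤ max C 1 := by
  refine le_of_pow_le_pow_left₀ (Nat.succ_ne_zero k) (by positivity) ?_
  rw [Nat.succ_eq_add_one, regSlope_pow hδ]
  have h1 := h.snd_le_pow hη hδ hr
  have h2 : r ^ (k + 1) ≤ (max C 1) ^ (k + 1) :=
    pow_le_pow_left₀ hr.1 ((hr.2.trans hC).trans (le_max_left _ _)) _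
  exact max_le (h1.trans h2) (hδ1.trans (one_le_pow₀ (le_max_right _ _)))

theorem abs_deriv_snd_le (h : RegularizedShot k η δ R φ w) (hη : 0 ≤ η) (hη1 : η ≤ 1)
    (hδ : 0 < δ) {C r : ℝ} (hC : R ≤ C) (hr : r ∈ Icc 0 R) :
    |(k + 1) * r ^ k * profileSource k η (φ r)| ≤ (k + 1) * C ^ k := by
  have hr0 := hr.1
  rw [abs_mul, abs_of_nonneg (show 0 ≤ ((k : ℝ) + 1) * r ^ k by positivity)]
  have h1 := h.abs_source_le_one hη hη1 hδ hr
  have h2 : r ^ k ≤ C ^ k := pow_le_pow_left₀ hr0 (hr.2.trans hC) k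
  have h3 : 0 ≤ C := hr0.trans (hr.2.trans hC)
  calc ((k : ℝ) + 1) * r ^ k * |profileSource k η (φ r)| ≤ (k + 1) * C ^ k * 1 := by gcongr
    _ = _ := mul_one _

/-- In integrated form the equations pass to the limit under pointwise convergence, without control
of the derivatives. -/
theorem fst_eq_integral (h : RegularizedShot k η δ R φ w) {r : ℝ} (hr : r ∈ Icc 0 R) :
    φ r = 1 - ∫ s in (0)..r, regSlope k δ (w s) := by
  have hc : ContinuousOn (fun s => -regSlope k δ (w s)) (Icc 0 r) :=
    (continuous_regSlope.comp_continuousOn (h.cont_snd.mono (Icc_subset_Icc_right hr.2))).neg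
  have := intervalIntegral.integral_eq_sub_of_hasDerivAt_of_le hr.1
    (h.cont_fst.mono (Icc_subset_Icc_right hr.2))
    (fun x hx => h.deriv_fst x ⟨hx.1, hx.2.trans_le hr.2⟩) (hc.intervalIntegrable_of_Icc hr.1)
  rw [intervalIntegral.integral_neg, h.fst_zero] at this
  linarith

theorem snd_eq_integral (h : RegularizedShot k η δ R φ w) {r : ℝ} (hr : r ∈ Icc 0 R) :
    w r = ∫ s in (0)..r, (k + 1) * s ^ k * profileSource k η (φ s) := by
  have hc : ContinuousOn (fun s => (k + 1) * s ^ k * profileSource k η (φ s)) (Icc 0 r) :=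
    ContinuousOn.mul (by fun_prop) (continuous_profileSource.comp_continuousOn
      (h.cont_fst.mono (Icc_subset_Icc_right hr.2)))
  have := intervalIntegral.integral_eq_sub_of_hasDerivAt_of_le hr.1
    (h.cont_snd.mono (Icc_subset_Icc_right hr.2))
    (fun x hx => h.deriv_snd x ⟨hx.1, hx.2.trans_le hr.2⟩) (hc.intervalIntegrable_of_Icc hr.1)
  rw [h.snd_zero] at this
  linarith

end RegularizedShot

/-- For every regularisation there is a regularised solution whose two components vanish
simultaneously, with a parameter and an interval of existence in fixed compact intervals. -/
theorem exists_regularizedShot_uniform (k : ℕ) (hk : k ≠ 0) :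
    ∃ η₀ η₁ C : ℝ, 0 < η₀ ∧ η₁ < 1 ∧ 1 ≤ C ∧ ∀ δ, 0 < δ → δ ≤ 1 → ∃ η ∈ Icc η₀ η₁,
      ∃ R ∈ Icc 1 C, ∃ φ w, RegularizedShot k η δ R φ w ∧ w R = 0 := by
  obtain ⟨η₀, h0, h04, hleft⟩ := RegularizedShot.exists_forall_snd_nonneg k hk
  set η₁ : ℝ := (2 / ((k : ℝ) + 2)) ^ ((k : ℝ)⁻¹) with hη₁
  have h10 : 0 < η₁ := by positivity
  have hpow : η₁ ^ k = 2 / ((k : ℝ) + 2) := Real.rpow_inv_natCast_pow (by positivity) hk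
  have hk1 : (1 : ℝ) ≤ k := by exact_mod_cast Nat.one_le_iff_ne_zero.2 hk
  have h11 : η₁ < 1 := by
    by_contra! h
    have h1 : 1 ≤ η₁ ^ k := one_le_pow₀ h
    rw [hpow, le_div_iff₀ (by positivity)] at h1
    linarith
  have h01 : η₀ ≤ η₁ := by
    by_contra! h
    have h1 : η₁ ^ k ≤ (1 / 4) ^ k := pow_le_pow_left₀ h10.le (h.le.trans h04) k
    -- Bernoulli's inequality excludes `2 * 4^k ≤ k + 2`, which `η₁ < 1/4` would force.
    have h2 : 1 + (k : ℝ) * 3 ≤ (1 + 3) ^ k := one_add_mul_le_pow (by norm_num) k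
    rw [hpow, div_pow, one_pow, div_le_div_iff₀ (by positivity) (by positivity)] at h1
    norm_num at h2
    linarith
  obtain ⟨C, hC⟩ := RegularizedShot.exists_forall_le k hk h0 h11
  refine ⟨η₀, η₁, max C 1, h0, h11, le_max_right _ _, fun δ hδ hδ1 => ?_⟩
  obtain ⟨η, hη, R, φ, w, hs, hw⟩ := exists_regularizedShot_snd_eq_zero k hδ h0.le h01 h11.le
    (fun R φ w => hleft δ R φ w hδ hδ1) (fun R φ w h => h.snd_nonpos h10 h11 hδ hpow)
  exact ⟨η, hη, R, ⟨hs.one_le (h0.le.trans hη.1) hδ hδ1,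
    (hC η hη δ R φ w hδ hδ1 hs hw).trans (le_max_left _ _)⟩, φ, w, hs, hw⟩

theorem tendsto_regSlope {k : ℕ} {δ w : ℕ → ℝ} {a : ℝ} (hδ : Tendsto δ atTop (𝓝 0))
    (hw : Tendsto w atTop (𝓝 a)) :
    Tendsto (fun n => regSlope k (δ n) (w n)) atTop (𝓝 (regSlope k 0 a)) :=
  (hw.max hδ).rpow_const (Or.inr (by positivity))

/-- The integrated profile system has a solution on an interval whose two components vanish
simultaneously at the right end. -/
theorem exists_integral_profile (k : ℕ) (hk : k ≠ 0) :
    ∃ η ∈ Ioo (0 : ℝ) 1, ∃ R : ℝ, 0 < R ∧ ∃ φ w : ℝ → ℝ, Continuous φ ∧ Continuous w ∧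
      φ R = 0 ∧ w R = 0 ∧ (∀ r ∈ Icc 0 R, φ r = 1 - ∫ s in (0)..r, regSlope k 0 (w s)) ∧
      ∀ r ∈ Icc 0 R, w r = ∫ s in (0)..r, (k + 1) * s ^ k * profileSource k η (φ s) := by
  obtain ⟨η₀, η₁, C, h0, h1, hC1, hex⟩ := exists_regularizedShot_uniform k hk
  have hC0 : 0 ≤ C := by linarith
  set δ : ℕ → ℝ := fun n => 1 / ((n : ℝ) + 1) with hδ
  have hδ0 : ∀ n, 0 < δ n := fun n => by positivity
  have hδ1 : ∀ n, δ n ≤ 1 := fun n => by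
    simp only [hδ]; rw [div_le_one (by positivity)]
    have : (0 : ℝ) ≤ n := by positivity
    linarith
  have hδt : Tendsto δ atTop (𝓝 0) := tendsto_one_div_add_atTop_nhds_zero_nat
  choose η hη R hR φ w hs hw using fun n => hex (δ n) (hδ0 n) (hδ1 n)
  have hη0 : ∀ n, 0 ≤ η n := fun n => h0.le.trans (hη n).1
  have hη1 : ∀ n, η n ≤ 1 := fun n => (hη n).2.trans h1.le
  have hR0 : ∀ n, 0 ≤ R n := fun n => (hs n).pos.le
  -- Both components are frozen beyond `[0, R n]`, so that all of them live on the whole line with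
  -- one Lipschitz constant although `R n` varies.
  set p : ℕ → ℝ → ℝ := fun n x => φ n (max 0 (min x (R n))) with hp
  set q : ℕ → ℝ → ℝ := fun n x => w n (max 0 (min x (R n))) with hq
  set K : NNReal := max (max C 1).toNNReal ((k + 1) * C ^ k).toNNReal with hK
  have hpL : ∀ n, LipschitzWith K (p n) := fun n =>
    ((lipschitzOnWith_Icc_of_hasDerivAt (hs n).cont_fst (hs n).deriv_fst fun x hx => by
      rw [abs_neg, abs_of_pos (regSlope_pos (hδ0 n))]
      exact ((hs n).regSlope_le (hη0 n) (hδ0 n) (hδ1 n) (hR n).2 (Ioo_subset_Icc_self hx)).trans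
        (Real.le_coe_toNNReal _)).comp_clip (hR0 n)).weaken (le_max_left _ _)
  have hqL : ∀ n, LipschitzWith K (q n) := fun n =>
    ((lipschitzOnWith_Icc_of_hasDerivAt (hs n).cont_snd (hs n).deriv_snd fun x hx =>
      ((hs n).abs_deriv_snd_le (hη0 n) (hη1 n) (hδ0 n) (hR n).2 (Ioo_subset_Icc_self hx)).trans
        (Real.le_coe_toNNReal _)).comp_clip (hR0 n)).weaken (le_max_right _ _)
  have hpqL : ∀ n, LipschitzWith K fun x => (p n x, q n x) := fun n => by
    simpa using (hpL n).prodMk (hqL n)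
  have hp01 : ∀ n x, p n x ∈ Icc (0 : ℝ) 1 := fun n x =>
    ⟨(hs n).fst_nonneg (hδ0 n) (clip_mem (hR0 n) x), (hs n).fst_le_one (hδ0 n) (clip_mem (hR0 n) x)⟩
  have hqb : ∀ n x, q n x ∈ Icc (-(K * C)) (K * C) := fun n x => by
    have h2 := (hqL n).dist_le_mul (max 0 (min x (R n))) 0
    have h3 := clip_mem (hR0 n) x
    have h4 : q n (max 0 (min x (R n))) = q n x := by
      simp only [hq]; rw [clip_of_mem h3]
    have h5 : q n 0 = 0 := by
      simp only [hq]; rw [clip_of_mem (left_mem_Icc.2 (hR0 n)), (hs n).snd_zero]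
    rw [h4, h5, Real.dist_eq, Real.dist_eq, sub_zero, sub_zero, abs_of_nonneg h3.1] at h2
    refine abs_le.1 (h2.trans ?_)
    have := h3.2.trans (hR n).2
    gcongr
  obtain ⟨ψ, hψ, g, hg, hgt⟩ := exists_subseq_tendsto_of_lipschitzWith hC0
    ((isCompact_Icc (a := (0 : ℝ)) (b := 1)).prod (isCompact_Icc (a := -(K * C)) (b := K * C)))
    hpqL (fun n x => ⟨hp01 n x, hqb n x⟩)
  obtain ⟨⟨η', R'⟩, ⟨hη', hR'⟩, ψ', hψ', hlim⟩ :=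
    ((isCompact_Icc (a := η₀) (b := η₁)).prod (isCompact_Icc (a := 1) (b := C))).tendsto_subseq
      (x := fun n => (η (ψ n), R (ψ n))) fun n => ⟨hη _, hR _⟩
  simp only at hη' hR'
  set θ : ℕ → ℕ := ψ ∘ ψ' with hθ
  have hηt : Tendsto (fun n => η (θ n)) atTop (𝓝 η') := (continuous_fst.tendsto _).comp hlim
  have hRt : Tendsto (fun n => R (θ n)) atTop (𝓝 R') := (continuous_snd.tendsto _).comp hlim
  have hδθ : Tendsto (fun n => δ (θ n)) atTop (𝓝 0) := hδt.comp (hψ.comp hψ').tendsto_atTop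
  have hgt' : ∀ x ∈ Icc 0 C, Tendsto (fun n => (p (θ n) x, q (θ n) x)) atTop (𝓝 (g x)) :=
    fun x hx => (hgt x hx).comp hψ'.tendsto_atTop
  have hpt : ∀ x ∈ Icc 0 C, Tendsto (fun n => p (θ n) x) atTop (𝓝 (g x).1) :=
    fun x hx => (continuous_fst.tendsto _).comp (hgt' x hx)
  have hqt : ∀ x ∈ Icc 0 C, Tendsto (fun n => q (θ n) x) atTop (𝓝 (g x).2) :=
    fun x hx => (continuous_snd.tendsto _).comp (hgt' x hx)
  have hg1 : Continuous fun x => (g x).1 := continuous_fst.comp hg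
  have hg2 : Continuous fun x => (g x).2 := continuous_snd.comp hg
  have hRpos : 0 < R' := by linarith [hR'.1]
  have hRmem : R' ∈ Icc 0 C := ⟨hRpos.le, hR'.2⟩
  have hzero : ∀ {f : ℕ → ℝ → ℝ} {a : ℝ}, (∀ n, LipschitzWith K (f n)) →
      (∀ n, f n (R n) = 0) → Tendsto (fun n => f (θ n) R') atTop (𝓝 a) → a = 0 := by
    intro f a hf hfR hft
    refine tendsto_nhds_unique hft (squeeze_zero_norm (a := fun n => K * dist R' (R (θ n))) ?_ ?_)
    · intro n
      have := (hf (θ n)).dist_le_mul R' (R (θ n))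
      rwa [hfR, dist_zero_right] at this
    · have h2 : Tendsto (fun n => dist R' (R (θ n))) atTop (𝓝 (dist R' R')) :=
        tendsto_const_nhds.dist hRt
      rw [dist_self] at h2
      simpa using h2.const_mul (K : ℝ)
  have hsub : ∀ r ∈ Ico 0 R', ∀ᶠ n in atTop, r ≤ R (θ n) := fun r hr =>
    (hRt.eventually_const_lt hr.2).mono fun n hn => hn.le
  refine ⟨η', ⟨h0.trans_le hη'.1, hη'.2.trans_lt h1⟩, R', hRpos, fun x => (g x).1, fun x => (g x).2,
    hg1, hg2, hzero hpL (fun n => ?_) (hpt R' hRmem), hzero hqL (fun n => ?_) (hqt R' hRmem),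
    ?_, ?_⟩
  · simp only [hp]
    rw [clip_of_mem (right_mem_Icc.2 (hR0 n)), (hs n).fst_end]
  · simp only [hq]
    rw [clip_of_mem (right_mem_Icc.2 (hR0 n)), hw n]
  · rw [← closure_Ico hRpos.ne]
    have hcs : Continuous fun s => regSlope k 0 (g s).2 := continuous_regSlope.comp hg2
    refine EqOn.closure (fun r hr => ?_) hg1 (continuous_const.sub
      (intervalIntegral.continuous_primitive (fun a b => hcs.intervalIntegrable a b) 0))
    refine tendsto_nhds_unique (hpt r ⟨hr.1, hr.2.le.trans hR'.2⟩) ?_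
    have hint : Tendsto (fun n => ∫ s in (0)..r, regSlope k (δ (θ n)) (q (θ n) s)) atTop
        (𝓝 (∫ s in (0)..r, regSlope k 0 (g s).2)) := by
      refine intervalIntegral.tendsto_integral_filter_of_dominated_convergence (fun _ => max C 1)
        (Eventually.of_forall fun n =>
          (continuous_regSlope.comp (hqL _).continuous).aestronglyMeasurable)
        (Eventually.of_forall fun n => Eventually.of_forall fun s _ => ?_) (by simp)
        (Eventually.of_forall fun s hs' => ?_)
      · rw [Real.norm_of_nonneg (regSlope_pos (hδ0 _)).le]
        exact (hs _).regSlope_le (hη0 _) (hδ0 _) (hδ1 _) (hR _).2 (clip_mem (hR0 _) s)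
      · rw [uIoc_of_le hr.1] at hs'
        exact tendsto_regSlope hδθ (hqt s ⟨hs'.1.le, hs'.2.trans (hr.2.le.trans hR'.2)⟩)
    refine (hint.const_sub 1).congr' ?_
    filter_upwards [hsub r hr] with n hn
    have h2 : p (θ n) r = φ (θ n) r := by simp only [hp]; rw [clip_of_mem ⟨hr.1, hn⟩]
    rw [h2, (hs (θ n)).fst_eq_integral ⟨hr.1, hn⟩]
    congr 1
    refine intervalIntegral.integral_congr fun s hs' => ?_
    rw [uIcc_of_le hr.1] at hs'
    simp only [hq]
    rw [clip_of_mem ⟨hs'.1, hs'.2.trans hn⟩]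
  · rw [← closure_Ico hRpos.ne]
    have hcs : Continuous fun s : ℝ => (k + 1) * s ^ k * profileSource k η' (g s).1 :=
      Continuous.mul (by fun_prop) (continuous_profileSource.comp hg1)
    refine EqOn.closure (fun r hr => ?_) hg2
      (intervalIntegral.continuous_primitive (fun a b => hcs.intervalIntegrable a b) 0)
    refine tendsto_nhds_unique (hqt r ⟨hr.1, hr.2.le.trans hR'.2⟩) ?_
    have hint : Tendsto (fun n => ∫ s in (0)..r,
        (k + 1) * s ^ k * profileSource k (η (θ n)) (p (θ n) s)) atTop
        (𝓝 (∫ s in (0)..r, (k + 1) * s ^ k * profileSource k η' (g s).1)) := by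
      refine intervalIntegral.tendsto_integral_filter_of_dominated_convergence
        (fun _ => (k + 1) * C ^ k) (Eventually.of_forall fun n =>
          (Continuous.mul (by fun_prop) (continuous_profileSource.comp
            (hpL _).continuous)).aestronglyMeasurable) ?_ (by simp)
        (Eventually.of_forall fun s hs' => ?_)
      · filter_upwards [hsub r hr] with n hn
        refine Eventually.of_forall fun s hs' => ?_
        rw [uIoc_of_le hr.1] at hs'
        have hsR : s ∈ Icc 0 (R (θ n)) := ⟨hs'.1.le, hs'.2.trans hn⟩
        simp only [hp]
        rw [clip_of_mem hsR]
        exact (hs _).abs_deriv_snd_le (hη0 _) (hη1 _) (hδ0 _) (hR _).2 hsR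
      · rw [uIoc_of_le hr.1] at hs'
        have h3 := hpt s ⟨hs'.1.le, hs'.2.trans (hr.2.le.trans hR'.2)⟩
        exact ((h3.pow (k + 1)).sub ((hηt.pow k).mul h3)).const_mul _
    refine hint.congr' ?_
    filter_upwards [hsub r hr] with n hn
    have h2 : q (θ n) r = w (θ n) r := by simp only [hq]; rw [clip_of_mem ⟨hr.1, hn⟩]
    rw [h2, (hs (θ n)).snd_eq_integral ⟨hr.1, hn⟩]
    refine intervalIntegral.integral_congr fun s hs' => ?_
    rw [uIcc_of_le hr.1] at hs'
    simp only [hp]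
    rw [clip_of_mem ⟨hs'.1, hs'.2.trans hn⟩]

/-! ### Construction of the compactly supported profile -/

/-- A nonincreasing solution `F` of the profile equation in dimension `k + 1` with support `[0, L]`,
extended to the whole line by its value at `0`, together with its slope `g = -F'`. -/
structure CompactProfile (k : ℕ) (L : ℝ) (F g : ℝ → ℝ) : Prop where
  length_pos : 0 < L
  continuous_slope : Continuous g
  hasDerivAt : ∀ r, HasDerivAt F (-g r) r
  hasDerivAt_flux : ∀ r, HasDerivAt (fun s => g s ^ (k + 1))
    ((k + 1) * max r 0 ^ k * (F r ^ (k + 1) - F r)) r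
  slope_pos : ∀ r ∈ Ioo 0 L, 0 < g r
  slope_eq_zero : ∀ r, r ∉ Ioo 0 L → g r = 0
  pos : ∀ r ∈ Ico 0 L, 0 < F r
  eq_zero : ∀ r, L ≤ r → F r = 0
  one_lt : 1 < F 0

/-- The primitive of a continuous function vanishing outside `(0, L)`. -/
theorem integral_eq_integral_clip {f fb : ℝ → ℝ} {L : ℝ} (hL : 0 ≤ L) (hc : Continuous fb)
    (h1 : ∀ s ∈ Icc 0 L, fb s = f s) (h2 : ∀ s ≤ 0, fb s = 0) (h3 : ∀ s, L ≤ s → fb s = 0) (r : ℝ) :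
    ∫ s in (0)..r, fb s = ∫ s in (0)..(max 0 (min r L)), f s := by
  have hcongr : ∀ x ∈ Icc 0 L, ∫ s in (0)..x, fb s = ∫ s in (0)..x, f s := fun x hx =>
    intervalIntegral.integral_congr fun s hs => by
      rw [uIcc_of_le hx.1] at hs
      exact h1 s ⟨hs.1, hs.2.trans hx.2⟩
  have hzero : ∀ a b, (∀ s ∈ uIcc a b, fb s = 0) → ∫ s in a..b, fb s = 0 := fun a b h => by
    rw [intervalIntegral.integral_congr (g := fun _ => (0 : ℝ)) h]
    simp
  rcases le_total r 0 with hr | hr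
  · rw [min_eq_left (hr.trans hL), max_eq_left hr, intervalIntegral.integral_same]
    refine hzero _ _ fun s hs => h2 s ?_
    rw [uIcc_of_ge hr] at hs
    exact hs.2
  rcases le_total r L with hrL | hrL
  · rw [clip_of_mem ⟨hr, hrL⟩, hcongr r ⟨hr, hrL⟩]
  · rw [min_eq_right hrL, max_eq_right hL, ← hcongr L ⟨hL, le_rfl⟩,
      ← intervalIntegral.integral_add_adjacent_intervals (hc.intervalIntegrable 0 L)
        (hc.intervalIntegrable L r), hzero L r fun s hs => h3 s ?_, add_zero]
    rw [uIcc_of_le hrL] at hs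
    exact hs.1

theorem Continuous.hasDerivAt_primitive {f : ℝ → ℝ} (hf : Continuous f) (r : ℝ) :
    HasDerivAt (fun x => ∫ s in (0)..x, f s) (f r) r :=
  intervalIntegral.integral_hasDerivAt_right (hf.intervalIntegrable _ _)
    hf.aestronglyMeasurable.stronglyMeasurableAtFilter hf.continuousAt

theorem exists_compactProfile (k : ℕ) (hk : k ≠ 0) : ∃ L F g, CompactProfile k L F g := by
  obtain ⟨η, hη, R, hR, φ, w, hφc, hwc, hφR, hwR, hφ, hw⟩ := exists_integral_profile k hk
  have hγ0 : ∀ x, 0 ≤ regSlope k 0 x := fun x => Real.rpow_nonneg (le_max_right _ _) _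
  have hγc : Continuous fun s => regSlope k 0 (w s) := continuous_regSlope.comp hwc
  have hsc : Continuous fun s : ℝ => (k + 1) * s ^ k * profileSource k η (φ s) :=
    Continuous.mul (by fun_prop) (continuous_profileSource.comp hφc)
  have hφsub : ∀ r ∈ Icc 0 R, ∀ s ∈ Icc 0 R, φ s - φ r = ∫ x in s..r, regSlope k 0 (w x) := by
    intro r hr s hs
    rw [hφ r hr, hφ s hs, ← intervalIntegral.integral_interval_sub_left
      (hγc.intervalIntegrable 0 r) (hγc.intervalIntegrable 0 s)]
    ring
  have hwsub : ∀ r ∈ Icc 0 R, ∀ s ∈ Icc 0 R,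
      w r - w s = ∫ x in s..r, (k + 1) * x ^ k * profileSource k η (φ x) := by
    intro r hr s hs
    rw [hw r hr, hw s hs, ← intervalIntegral.integral_interval_sub_left
      (hsc.intervalIntegrable 0 r) (hsc.intervalIntegrable 0 s)]
  have hanti : AntitoneOn φ (Icc 0 R) := fun s hs r hr hsr => by
    have h1 := hφsub r hr s hs
    have h2 : 0 ≤ ∫ x in s..r, regSlope k 0 (w x) :=
      intervalIntegral.integral_nonneg hsr fun x _ => hγ0 (w x)
    linarith
  have hφ0 : φ 0 = 1 := by simpa using hφ 0 ⟨le_rfl, hR.le⟩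
  have hw0 : w 0 = 0 := by simpa using hw 0 ⟨le_rfl, hR.le⟩
  -- Without regularisation `φ` is only known to be nonincreasing and might reach zero before `R`.
  -- The interface is therefore its first zero.
  obtain ⟨L, ⟨hLmem, hL0⟩, hLleast⟩ :=
    (isCompact_Icc.inter_right (isClosed_singleton.preimage hφc) :
      IsCompact (Icc 0 R ∩ φ ⁻¹' {0})).exists_isLeast ⟨R, ⟨hR.le, le_rfl⟩, hφR⟩
  simp only [mem_preimage, mem_singleton_iff] at hL0
  have hLpos : 0 < L := by
    refine lt_of_le_of_ne hLmem.1 ?_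
    rintro rfl
    linarith
  have hsubI : Icc 0 L ⊆ Icc 0 R := Icc_subset_Icc_right hLmem.2
  have hφpos : ∀ r ∈ Ico 0 L, 0 < φ r := fun r hr => by
    have hr' : r ∈ Icc 0 R := ⟨hr.1, hr.2.le.trans hLmem.2⟩
    refine lt_of_le_of_ne (hL0 ▸ hanti hr' hLmem hr.2.le) fun h => ?_
    exact absurd (hLleast ⟨hr', h.symm⟩) (not_le.2 hr.2)
  have hsource0 : profileSource k η 0 = 0 := by simp [profileSource]
  -- Between `L` and `R` both `φ` and the source vanish, so the flux keeps its value `w R = 0`.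
  have hwL : w L = 0 := by
    have h1 := hwsub R ⟨hR.le, le_rfl⟩ L hLmem
    rw [intervalIntegral.integral_congr (g := fun _ => (0 : ℝ)) fun x hx => ?_] at h1
    · simp only [intervalIntegral.integral_zero] at h1
      linarith
    · rw [uIcc_of_le hLmem.2] at hx
      have hx' : x ∈ Icc 0 R := ⟨hLmem.1.trans hx.1, hx.2⟩
      have h2 : φ x = 0 := le_antisymm (hL0 ▸ hanti hLmem hx' hx.1)
        (hφR ▸ hanti hx' ⟨hR.le, le_rfl⟩ hx.2)
      simp [h2, hsource0]
  have hwpos : ∀ r ∈ Ioo 0 L, 0 < w r := fun r hr => by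
    have hr' : r ∈ Icc 0 R := ⟨hr.1.le, hr.2.le.trans hLmem.2⟩
    -- While `φ ≥ η` the flux has accumulated a nonnegative source, positive near `0`. Once `φ < η`
    -- the source is negative up to `L`, where the flux is zero, so the flux was positive before.
    rcases le_or_gt η (φ r) with h | h
    · rw [hw r hr']
      refine intervalIntegral.integral_pos hr.1 hsc.continuousOn (fun x hx => ?_) ?_
      · have hx0 := hx.1.le
        refine mul_nonneg (by positivity) (profileSource_nonneg hη.1.le (h.trans ?_))
        exact hanti ⟨hx0, hx.2.trans hr'.2⟩ hr' hx.2
      · have h1 : ∀ᶠ x in 𝓝[>] (0 : ℝ), η < φ x :=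
          (hφc.tendsto 0).eventually_const_lt (by rw [hφ0]; exact hη.2) |>.filter_mono
            nhdsWithin_le_nhds
        obtain ⟨x, hx1, hx2⟩ := (h1.and (Ioo_mem_nhdsGT hr.1)).exists
        have hx0 := hx2.1
        exact ⟨x, ⟨hx2.1.le, hx2.2.le⟩,
          mul_pos (by positivity) (profileSource_pos hk hη.1.le hx1)⟩
    · have h1 := hwsub L hLmem r hr'
      have h2 : 0 < ∫ x in r..L, -((k + 1) * x ^ k * profileSource k η (φ x)) := by
        refine intervalIntegral.intervalIntegral_pos_of_pos_on
          (hsc.neg.intervalIntegrable _ _) (fun x hx => ?_) hr.2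
        have hx0 : 0 < x := hr.1.trans hx.1
        have h3 : φ x ≤ φ r := hanti hr' ⟨hx0.le, hx.2.le.trans hLmem.2⟩ hx.1.le
        have h4 := profileSource_neg hk (hφpos x ⟨hx0.le, hx.2⟩) (h3.trans_lt h)
        have h5 : 0 < ((k : ℝ) + 1) * x ^ k := by positivity
        nlinarith
      rw [intervalIntegral.integral_neg] at h2
      linarith
  -- Composing with the clip to `[0, L]` extends both components by constants. The extension
  -- satisfies the equations on the whole line because the slope and the weighted source vanish at
  -- `0` and at `L`.
  set c : ℝ → ℝ := fun r => max 0 (min r L) with hc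
  have hcc : Continuous c := (lipschitzWith_clip 0 L).continuous
  have hcmem : ∀ r, c r ∈ Icc 0 L := clip_mem hLpos.le
  have hcid : ∀ r ∈ Icc 0 L, c r = r := fun r hr => clip_of_mem hr
  have hcneg : ∀ r ≤ 0, c r = 0 := fun r hr => by
    simp only [hc]; rw [min_eq_left (hr.trans hLpos.le), max_eq_left hr]
  have hcL : ∀ r, L ≤ r → c r = L := fun r hr => by
    simp only [hc]; rw [min_eq_right hr, max_eq_right hLpos.le]
  have hwc0 : ∀ r, 0 ≤ w (c r) := fun r => by
    rcases (hcmem r).1.eq_or_lt with h | h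
    · rw [← h, hw0]
    rcases (hcmem r).2.eq_or_lt with h' | h'
    · rw [h', hwL]
    · exact (hwpos _ ⟨h, h'⟩).le
  have hγz : regSlope k 0 0 = 0 := by
    simp only [regSlope, max_self]
    exact Real.zero_rpow (by positivity)
  have hφd : ∀ r, HasDerivAt (fun r => φ (c r)) (-regSlope k 0 (w (c r))) r := fun r => by
    have hcont : Continuous fun s => regSlope k 0 (w (c s)) := hγc.comp hcc
    refine (((hcont.hasDerivAt_primitive r).const_sub 1)).congr_of_eventuallyEq
      (Eventually.of_forall fun x => ?_)
    simp only
    rw [hφ _ (hsubI (hcmem x)), integral_eq_integral_clip hLpos.le hcont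
      (f := fun s => regSlope k 0 (w s)) (fun s hs => by rw [hcid s hs])
      (fun s hs => by rw [hcneg s hs, hw0, hγz]) (fun s hs => by rw [hcL s hs, hwL, hγz])]
  have hwd : ∀ r, HasDerivAt (fun r => w (c r))
      ((k + 1) * max r 0 ^ k * profileSource k η (φ (c r))) r := fun r => by
    have hcont : Continuous fun s : ℝ => (k + 1) * max s 0 ^ k * profileSource k η (φ (c s)) :=
      Continuous.mul (by fun_prop) (continuous_profileSource.comp (hφc.comp hcc))
    refine (hcont.hasDerivAt_primitive r).congr_of_eventuallyEq
      (Eventually.of_forall fun x => ?_)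
    simp only
    rw [hw _ (hsubI (hcmem x)), integral_eq_integral_clip hLpos.le hcont
      (f := fun s => (k + 1) * s ^ k * profileSource k η (φ s))
      (fun s hs => by rw [hcid s hs, max_eq_left hs.1])
      (fun s hs => by rw [max_eq_right hs, zero_pow hk]; ring)
      (fun s hs => by rw [hcL s hs, hL0, hsource0, mul_zero])]
  have hpow : ∀ s, (regSlope k 0 (w (c s)) / η) ^ (k + 1) = w (c s) / η ^ (k + 1) := fun s => by
    rw [div_pow, regSlope, max_eq_left (hwc0 s), ← Real.rpow_natCast, ← Real.rpow_mul (hwc0 s)]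
    have : (k : ℝ) + 1 ≠ 0 := by positivity
    push_cast
    rw [one_div_mul_cancel this, Real.rpow_one]
  refine ⟨L, fun r => φ (c r) / η, fun r => regSlope k 0 (w (c r)) / η, hLpos,
    (hγc.comp hcc).div_const η, fun r => ?_, fun r => ?_, fun r hr => ?_, fun r hr => ?_,
    fun r hr => ?_, fun r hr => ?_, ?_⟩
  · exact ((hφd r).div_const η).congr_deriv (neg_div _ _)
  · simp only [hpow]
    refine ((hwd r).div_const _).congr_deriv ?_
    have := hη.1.ne'
    rw [profileSource, div_pow]
    field_simp
    ring
  · refine div_pos (Real.rpow_pos_of_pos (lt_max_of_lt_left ?_) _) hη.1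
    rw [hcid r (Ioo_subset_Icc_self hr)]
    exact hwpos r hr
  · have : w (c r) = 0 := by
      by_cases h : r ≤ 0
      · rw [hcneg r h, hw0]
      · rw [hcL r (by by_contra! h'; exact hr ⟨not_le.1 h, h'⟩), hwL]
    simp only [this, hγz, zero_div]
  · simp only [hcid r (Ico_subset_Icc_self hr)]
    exact div_pos (hφpos r hr) hη.1
  · simp only [hcL r hr, hL0, zero_div]
  · simp only [hcneg 0 le_rfl, hφ0]
    exact one_lt_one_div hη.1 hη.2

/-! ### Regularity and equation of the profile -/

namespace CompactProfile

variable {k : ℕ} {L : ℝ} {F g : ℝ → ℝ}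

theorem deriv_eq (h : CompactProfile k L F g) : deriv F = fun r => -g r :=
  funext fun r => (h.hasDerivAt r).deriv

theorem contDiff (h : CompactProfile k L F g) : ContDiff ℝ 1 F :=
  contDiff_one_iff_deriv.2 ⟨fun r => (h.hasDerivAt r).differentiableAt,
    h.deriv_eq ▸ h.continuous_slope.neg⟩

theorem slope_nonneg (h : CompactProfile k L F g) (r : ℝ) : 0 ≤ g r := by
  by_cases hr : r ∈ Ioo 0 L
  · exact (h.slope_pos r hr).le
  · exact (h.slope_eq_zero r hr).ge

theorem antitone (h : CompactProfile k L F g) : Antitone F :=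
  antitone_of_deriv_nonpos h.contDiff.differentiable_one fun r => by
    rw [h.deriv_eq]
    exact neg_nonpos.2 (h.slope_nonneg r)

theorem nonneg (h : CompactProfile k L F g) (r : ℝ) : 0 ≤ F r := by
  have := h.antitone (le_max_left r L)
  rwa [h.eq_zero _ (le_max_right r L)] at this

/-- Homogeneity of degree `k + 1` of the flux. The factor `c = 1` serves the profile problem, the
time-dependent amplitude serves the flow. -/
theorem hasRadialMA (h : CompactProfile k L F g) {r : ℝ} (hr : 0 ≤ r) (c : ℝ) :
    HasRadialMA (k + 1) (fun s => c * F s) r (|c| ^ k * c * (F r - F r ^ (k + 1))) := by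
  have h1 : (fun s => |deriv (fun s => c * F s) s| ^ (k + 1 - 1) * deriv (fun s => c * F s) s) =
      fun s => -(|c| ^ k * c) * g s ^ (k + 1) := funext fun s => by
    rw [((h.hasDerivAt s).const_mul c).deriv, Nat.add_sub_cancel, abs_mul, abs_neg,
      abs_of_nonneg (h.slope_nonneg s)]
    ring
  rw [HasRadialMA, h1]
  refine ((h.hasDerivAt_flux r).const_mul _).congr_deriv ?_
  rw [max_eq_left hr, Nat.add_sub_cancel]
  push_cast
  ring

theorem isRadialProfile (h : CompactProfile k L F g) : IsRadialProfile (k + 1) F where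
  contDiffOn := h.contDiff.contDiffOn
  equation r hr := by
    have := h.hasRadialMA hr.le 1
    simp only [one_mul, abs_one, one_pow] at this
    rw [Nat.add_sub_cancel, abs_of_nonneg (h.nonneg r), ← pow_succ]
    exact this
  deriv_nonpos r _ := by
    rw [h.deriv_eq]
    exact neg_nonpos.2 (h.slope_nonneg r)
  deriv_zero := by
    rw [(h.hasDerivAt 0).hasDerivWithinAt.derivWithin (uniqueDiffOn_Ici 0 0 self_mem_Ici),
      h.slope_eq_zero 0 (by simp), neg_zero]
  tendsto_zero := tendsto_const_nhds.congr' <| (eventually_ge_atTop L).mono fun r hr =>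
    (h.eq_zero r hr).symm

theorem support_eq (h : CompactProfile k L F g) : {r : ℝ | 0 ≤ r ∧ F r ≠ 0} = Ico 0 L := by
  ext r
  refine ⟨fun hr => ⟨hr.1, ?_⟩, fun hr => ⟨hr.1, (h.pos r hr).ne'⟩⟩
  by_contra! h'
  exact hr.2 (h.eq_zero r h')

theorem closure_support (h : CompactProfile k L F g) :
    closure {r : ℝ | 0 ≤ r ∧ F r ≠ 0} = Icc 0 L := by
  rw [h.support_eq, closure_Ico h.length_pos.ne]

theorem contDiff_flux (h : CompactProfile k L F g) : ContDiff ℝ 1 fun s => g s ^ (k + 1) := by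
  refine contDiff_one_iff_deriv.2 ⟨fun r => (h.hasDerivAt_flux r).differentiableAt, ?_⟩
  have hF := h.contDiff.continuous
  rw [funext fun r => (h.hasDerivAt_flux r).deriv]
  fun_prop

/-- The slope is the `(k+1)`-th root of a `C¹` flux, and the root is smooth where the flux is
positive. -/
theorem contDiffOn_slope (h : CompactProfile k L F g) : ContDiffOn ℝ 1 g (Ioo 0 L) := by
  have h1 : ContDiffOn ℝ 1 (fun s => (g s ^ (k + 1)) ^ ((↑(k + 1) : ℝ)⁻¹)) (Ioo 0 L) :=
    h.contDiff_flux.contDiffOn.rpow_const_of_ne fun r hr => (pow_pos (h.slope_pos r hr) _).ne'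
  exact h1.congr fun r hr => (Real.pow_rpow_inv_natCast (h.slope_nonneg r) k.succ_ne_zero).symm

theorem contDiffOn_two (h : CompactProfile k L F g) : ContDiffOn ℝ 2 F (Ioo 0 L) := by
  rw [show (2 : WithTop ℕ∞) = 1 + 1 by norm_num, contDiffOn_succ_iff_deriv_of_isOpen isOpen_Ioo]
  refine ⟨h.contDiff.differentiable_one.differentiableOn, by simp, ?_⟩
  rw [h.deriv_eq]
  exact h.contDiffOn_slope.neg

theorem hasDerivAt_slope (h : CompactProfile k L F g) {r : ℝ} (hr : r ∈ Ioo 0 L) :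
    HasDerivAt g (r ^ k * (F r ^ (k + 1) - F r) / g r ^ k) r := by
  have hg := h.slope_pos r hr
  have h1 : HasDerivAt g (deriv g r) r :=
    ((h.contDiffOn_slope.differentiableOn one_ne_zero).differentiableAt
      (Ioo_mem_nhds hr.1 hr.2)).hasDerivAt
  have h2 := (h1.pow (k + 1)).unique (h.hasDerivAt_flux r)
  refine h1.congr_deriv ?_
  rw [eq_div_iff (pow_pos hg k).ne']
  rw [max_eq_left hr.1.le, Nat.add_sub_cancel] at h2
  have h3 : ((k : ℝ) + 1) ≠ 0 := by positivity
  push_cast at h2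
  apply mul_left_cancel₀ h3
  linarith

theorem classical (h : CompactProfile k L F g) {r : ℝ} (hr : r ∈ Ioo 0 L) :
    1 / r ^ k * |deriv F r| ^ k * deriv (deriv F) r - F r + |F r| ^ k * F r = 0 := by
  have hg := h.slope_pos r hr
  have hr0 := hr.1
  rw [h.deriv_eq, (h.hasDerivAt_slope hr).fun_neg.deriv, abs_neg, abs_of_pos hg,
    abs_of_nonneg (h.nonneg r)]
  field_simp
  ring

/-! ### Behaviour at the interface -/

/-- The slope at the interface in terms of the height. -/
theorem tendsto_slope_pow_div (h : CompactProfile k L F g) (hk : k ≠ 0) :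
    Tendsto (fun r => g r ^ (k + 2) / F r ^ 2) (𝓝[<] L) (𝓝 (((k : ℝ) + 2) * L ^ k / 2)) := by
  have hF := h.contDiff.continuous
  have hFL := h.eq_zero L le_rfl
  have hgL := h.slope_eq_zero L (by simp)
  -- Since `g^k g' = r^k (F^(k+1) - F)`, the quotient of the derivatives is `(k+2) r^k (1 - F^k) /
  -- 2`, which is continuous up to `L`.
  refine HasDerivAt.lhopital_zero_left_on_Ioo h.length_pos
    (fun r hr => (h.hasDerivAt_slope hr).fun_pow (k + 2)) (fun r _ => (h.hasDerivAt r).fun_pow 2)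
    (fun r hr => ?_) ?_ ?_ ?_
  · have h1 := h.slope_pos r hr
    have h2 := h.pos r ⟨hr.1.le, hr.2⟩
    simp [h1.ne', h2.ne']
  · have : Tendsto (fun r => g r ^ (k + 2)) (𝓝 L) (𝓝 (g L ^ (k + 2))) :=
      (h.continuous_slope.pow (k + 2)).tendsto L
    rw [hgL, zero_pow (by omega)] at this
    exact this.mono_left nhdsWithin_le_nhds
  · have : Tendsto (fun r => F r ^ 2) (𝓝 L) (𝓝 (F L ^ 2)) := (hF.pow 2).tendsto L
    rw [hFL, zero_pow (by omega)] at this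
    exact this.mono_left nhdsWithin_le_nhds
  · have h3 : Continuous fun r => ((k : ℝ) + 2) * r ^ k * (1 - F r ^ k) / 2 := by fun_prop
    have h4 := (h3.tendsto L).mono_left (nhdsWithin_le_nhds (s := Iio L))
    rw [hFL, zero_pow hk, sub_zero, mul_one] at h4
    refine h4.congr' ?_
    filter_upwards [Ioo_mem_nhdsLT h.length_pos] with r hr
    have h1 := h.slope_pos r hr
    have h2 := h.pos r ⟨hr.1.le, hr.2⟩
    rw [show k + 2 - 1 = k + 1 by omega]
    push_cast
    field_simp
    ring

/-- The behaviour of the profile at the interface. -/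
theorem tendsto_div_rpow (h : CompactProfile k L F g) (hk : k ≠ 0) :
    Tendsto (fun r => F r / (L - r) ^ (((k : ℝ) + 2) / k)) (𝓝[<] L)
      (𝓝 (L * ((k : ℝ) ^ (k + 2) / (2 * ((k : ℝ) + 2) ^ (k + 1))) ^ (1 / (k : ℝ)))) := by
  have hF := h.contDiff.continuous
  have hFL := h.eq_zero L le_rfl
  have hL := h.length_pos
  have hk0 : (0 : ℝ) < k := by exact_mod_cast Nat.pos_of_ne_zero hk
  have hk2 : (k : ℝ) + 2 ≠ 0 := by positivity
  -- The derivative of `F^(k/(k+2))` is `-(k/(k+2)) (g^(k+2) / F²)^(1/(k+2))`, so this power of `F`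
  -- vanishes linearly at `L`, and `κ` is its rate.
  set κ : ℝ := k / (k + 2) * (((k : ℝ) + 2) * L ^ k / 2) ^ (1 / ((k : ℝ) + 2)) with hκ
  have hq : Tendsto (fun r => F r ^ ((k : ℝ) / (k + 2)) / (L - r)) (𝓝[<] L) (𝓝 κ) := by
    refine HasDerivAt.lhopital_zero_left_on_Ioo hL
      (fun r hr => (h.hasDerivAt r).rpow_const (Or.inl (h.pos r ⟨hr.1.le, hr.2⟩).ne'))
      (fun r _ => (hasDerivAt_id r).const_sub L) (fun r _ => by simp) ?_ ?_ ?_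
    · have : Tendsto (fun r => F r ^ ((k : ℝ) / (k + 2))) (𝓝 L) (𝓝 (F L ^ ((k : ℝ) / (k + 2)))) :=
        (hF.rpow_const fun _ => Or.inr (by positivity)).tendsto L
      rw [hFL, Real.zero_rpow (by positivity)] at this
      exact this.mono_left nhdsWithin_le_nhds
    · have : Tendsto (fun r => L - r) (𝓝 L) (𝓝 (L - L)) :=
        (continuous_const.sub continuous_id).tendsto L
      rw [sub_self] at this
      exact this.mono_left nhdsWithin_le_nhds
    · refine (((h.tendsto_slope_pow_div hk).rpow_const
        (p := 1 / ((k : ℝ) + 2)) (Or.inr (by positivity))).const_mul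
          ((k : ℝ) / (k + 2))).congr' ?_
      filter_upwards [Ioo_mem_nhdsLT hL] with r hr
      have h1 := h.slope_pos r hr
      have h2 := h.pos r ⟨hr.1.le, hr.2⟩
      have h3 : (k : ℝ) / (k + 2) - 1 = -(2 / ((k : ℝ) + 2)) := by field_simp; ring
      rw [Real.div_rpow (by positivity) (by positivity), ← Real.rpow_natCast, ← Real.rpow_natCast,
        ← Real.rpow_mul h1.le, ← Real.rpow_mul h2.le, h3, Real.rpow_neg h2.le]
      push_cast
      rw [mul_one_div_cancel hk2, Real.rpow_one, mul_one_div]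
      field_simp
  have hp := hq.rpow_const (p := ((k : ℝ) + 2) / k) (Or.inr (by positivity))
  have hκp : κ ^ (((k : ℝ) + 2) / k) =
      L * ((k : ℝ) ^ (k + 2) / (2 * ((k : ℝ) + 2) ^ (k + 1))) ^ (1 / (k : ℝ)) := by
    have h1 : κ ^ (k + 2) = L ^ k * ((k : ℝ) ^ (k + 2) / (2 * ((k : ℝ) + 2) ^ (k + 1))) := by
      rw [hκ, mul_pow, div_pow, ← Real.rpow_natCast (_ ^ (1 / ((k : ℝ) + 2))), ← Real.rpow_mul
        (by positivity)]
      push_cast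
      rw [one_div_mul_cancel hk2, Real.rpow_one]
      field_simp
      ring
    have hκ0 : 0 ≤ κ := by positivity
    rw [show ((k : ℝ) + 2) / k = ((k + 2 : ℕ) : ℝ) * (1 / k) by push_cast; ring,
      Real.rpow_mul hκ0, Real.rpow_natCast, h1, Real.mul_rpow (by positivity) (by positivity),
      one_div, Real.pow_rpow_inv_natCast hL.le hk]
  rw [hκp] at hp
  refine hp.congr' ?_
  filter_upwards [Ioo_mem_nhdsLT hL] with r hr
  have h2 := h.pos r ⟨hr.1.le, hr.2⟩
  have h3 : (k : ℝ) / (k + 2) * ((k + 2) / k) = 1 := by field_simp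
  rw [Real.div_rpow (by positivity) (sub_nonneg.2 hr.2.le), ← Real.rpow_mul h2.le, h3,
    Real.rpow_one]

/-- The limit of the quotient covers the left of `L`; at `L` and to its right both functions are
zero. -/
theorem isEquivalent (h : CompactProfile k L F g) (hk : k ≠ 0) :
    Asymptotics.IsEquivalent (𝓝 L) F fun z =>
      L * ((k : ℝ) ^ (k + 2) / (2 * ((k : ℝ) + 2) ^ (k + 1))) ^ (1 / (k : ℝ)) *
        max (L - z) 0 ^ (((k : ℝ) + 2) / k) := by
  have hL := h.length_pos
  have hk0 : (0 : ℝ) < k := by exact_mod_cast Nat.pos_of_ne_zero hk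
  set A : ℝ := L * ((k : ℝ) ^ (k + 2) / (2 * ((k : ℝ) + 2) ^ (k + 1))) ^ (1 / (k : ℝ)) with hA
  have hA0 : 0 < A := by positivity
  rw [Asymptotics.IsEquivalent, ← nhdsLT_sup_nhdsGE, Asymptotics.isLittleO_sup]
  constructor
  · refine Asymptotics.isEquivalent_of_tendsto_one ?_
    have h1 := (h.tendsto_div_rpow hk).div_const A
    rw [← hA, div_self hA0.ne'] at h1
    refine h1.congr' ?_
    filter_upwards [self_mem_nhdsWithin] with r hr
    rw [Pi.div_apply, max_eq_left (sub_nonneg.2 (le_of_lt hr)), div_div, mul_comm A]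
  · refine Asymptotics.IsEquivalent.refl.congr_left ?_
    filter_upwards [self_mem_nhdsWithin] with r hr
    rw [h.eq_zero r hr, max_eq_right (sub_nonpos.2 hr), Real.zero_rpow (by positivity), mul_zero]

/-! ### The separable flow and its blow-up set -/

/-- The amplitude solves `c' = c^(k+1)`. Hence `c' F` splits as `c^(k+1) (F - F^(k+1)) + (c
F)^(k+1)`, operator plus reaction. -/
theorem hasDerivAt_amplitude {k : ℕ} (hk : k ≠ 0) {T t : ℝ} (ht : t < T) :
    HasDerivAt (fun t => ((k : ℝ) * (T - t)) ^ (-(1 / (k : ℝ))))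
      ((((k : ℝ) * (T - t)) ^ (-(1 / (k : ℝ)))) ^ (k + 1)) t := by
  have hk0 : (0 : ℝ) < k := by exact_mod_cast Nat.pos_of_ne_zero hk
  have hX : 0 < (k : ℝ) * (T - t) := mul_pos hk0 (sub_pos.2 ht)
  have h1 := (((hasDerivAt_id t).const_sub T).const_mul (k : ℝ)).rpow_const
    (p := -(1 / (k : ℝ))) (Or.inl hX.ne')
  refine h1.congr_deriv ?_
  rw [← Real.rpow_natCast, ← Real.rpow_mul hX.le]
  have h2 : -(1 / (k : ℝ)) * ((k + 1 : ℕ) : ℝ) = -(1 / (k : ℝ)) - 1 := by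
    push_cast; field_simp; ring
  rw [h2]
  simp only [id]
  field_simp

theorem isRadialMAFlow (h : CompactProfile k L F g) (hk : k ≠ 0) (T : ℝ) :
    IsRadialMAFlow (k + 1) T fun r t => ((k : ℝ) * (T - t)) ^ (-(1 / (k : ℝ))) * F r := by
  have hk0 : (0 : ℝ) < k := by exact_mod_cast Nat.pos_of_ne_zero hk
  have hc0 : ∀ t < T, 0 < ((k : ℝ) * (T - t)) ^ (-(1 / (k : ℝ))) := fun t ht =>
    Real.rpow_pos_of_pos (mul_pos hk0 (sub_pos.2 ht)) _
  refine ⟨?_, fun r t hr ht => ?_, fun r t _ ht => ?_, fun t ht => ?_⟩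
  · refine ContDiffOn.mul (ContDiffOn.rpow_const_of_ne (ContDiff.contDiffOn (by fun_prop))
      fun p hp => (mul_pos hk0 (sub_pos.2 hp.2)).ne') (h.contDiff.comp contDiff_fst).contDiffOn
  · refine ⟨_, h.hasRadialMA hr.le _, ?_⟩
    refine ((hasDerivAt_amplitude hk ht).mul_const (F r)).congr_deriv ?_
    rw [Nat.add_sub_cancel, abs_mul, abs_of_nonneg (h.nonneg r), abs_of_pos (hc0 t ht)]
    ring
  · rw [((h.hasDerivAt r).const_mul _).deriv]
    exact mul_nonpos_of_nonneg_of_nonpos (hc0 t ht).le (neg_nonpos.2 (h.slope_nonneg r))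
  · rw [((h.hasDerivAt 0).const_mul _).hasDerivWithinAt.derivWithin
      (uniqueDiffOn_Ici 0 0 self_mem_Ici), h.slope_eq_zero 0 (by simp), neg_zero, mul_zero]

theorem radialBlowUpSet_eq (h : CompactProfile k L F g) (hk : k ≠ 0) (T : ℝ) :
    radialBlowUpSet T (fun r t => ((k : ℝ) * (T - t)) ^ (-(1 / (k : ℝ))) * F r) = Icc 0 L := by
  have hk0 : (0 : ℝ) < k := by exact_mod_cast Nat.pos_of_ne_zero hk
  have hc : Tendsto (fun t => ((k : ℝ) * (T - t)) ^ (-(1 / (k : ℝ)))) (𝓝[<] T) atTop := by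
    refine (tendsto_rpow_neg_nhdsGT_zero (by simpa using hk0)).comp
      (tendsto_nhdsWithin_iff.2 ⟨?_, ?_⟩)
    · have h1 : Tendsto (fun t => (k : ℝ) * (T - t)) (𝓝 T) (𝓝 (k * (T - T))) :=
        (show Continuous fun t => (k : ℝ) * (T - t) by fun_prop).tendsto T
      rw [sub_self, mul_zero] at h1
      exact h1.mono_left nhdsWithin_le_nhds
    · filter_upwards [self_mem_nhdsWithin] with t ht
      exact mul_pos hk0 (sub_pos.2 ht)
  ext r
  constructor
  · rintro ⟨hr, hM⟩
    refine ⟨hr, ?_⟩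
    by_contra! hrL
    refine hM 0 ?_
    have h1 : ∀ᶠ q : ℝ × ℝ in 𝓝 (r, T), L < q.1 :=
      (continuous_fst.tendsto (r, T)).eventually_const_lt hrL
    filter_upwards [h1.filter_mono nhdsWithin_le_nhds] with q hq
    simp [h.eq_zero q.1 hq.le]
  · intro hr
    refine ⟨hr.1, fun M hev => ?_⟩
    rw [nhdsWithin_prod_eq] at hev
    -- Since `F L = 0`, the endpoint `r = L` cannot be reached along the fixed radius `r`. Radii
    -- near `r` with `F > 0` are used instead, each followed as `t → T`.
    have h1 : ∃ᶠ x in 𝓝[Ici 0] r, F x ≠ 0 := by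
      rw [← h.closure_support, mem_closure_iff_frequently] at hr
      exact frequently_nhdsWithin_iff.2 (hr.mono fun x hx => ⟨hx.2, hx.1⟩)
    obtain ⟨x, hx, hxM⟩ := (h1.and_eventually hev.curry).exists
    have hF : 0 < F x := lt_of_le_of_ne (h.nonneg x) hx.symm
    obtain ⟨t, ht1, ht2⟩ := (hxM.and ((hc.atTop_mul_const hF).eventually_gt_atTop M)).exists
    exact ht1 (ht2.trans_le (le_abs_self _))

end CompactProfile

theorem proposition2p1 (d : ℕ) (hd : 2 ≤ d) :
    ∃ (F : ℝ → ℝ) (L : ℝ), 0 < L ∧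
      -- `F` is a solution of the profile problem, nonnegative and monotone, with `F 0 > 1`
      IsRadialProfile d F ∧
      (∀ r, 0 ≤ r → 0 ≤ F r) ∧
      AntitoneOn F (Ici 0) ∧
      1 < F 0 ∧
      -- its support is `[0, L]`
      closure {r : ℝ | 0 ≤ r ∧ F r ≠ 0} = Icc 0 L ∧
      -- inside the support the equation holds in the classical sense
      ContDiffOn ℝ 2 F (Ioo 0 L) ∧
      (∀ r ∈ Ioo 0 L,
        1 / r ^ (d - 1) * |deriv F r| ^ (d - 1) * deriv (deriv F) r
          - F r + |F r| ^ (d - 1) * F r = 0) ∧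
      -- behaviour at the interface
      Asymptotics.IsEquivalent (𝓝 L) F (fun z =>
        L * (((d : ℝ) - 1) ^ (d + 1) / (2 * ((d : ℝ) + 1) ^ d)) ^ (1 / ((d : ℝ) - 1)) *
          (max (L - z) 0) ^ (((d : ℝ) + 1) / ((d : ℝ) - 1))) ∧
      -- the separable solution (for `d = 2` it is `F r / (T - t)`) blows up exactly on `[0, L]`
      (∀ T : ℝ,
        IsRadialMAFlow d T
          (fun r t => (((d : ℝ) - 1) * (T - t)) ^ (-(1 / ((d : ℝ) - 1))) * F r) ∧
        radialBlowUpSet T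
          (fun r t => (((d : ℝ) - 1) * (T - t)) ^ (-(1 / ((d : ℝ) - 1))) * F r) = Icc 0 L) := by
  obtain ⟨k, rfl⟩ : ∃ k, d = k + 1 := ⟨d - 1, by omega⟩
  have hk : k ≠ 0 := by omega
  obtain ⟨L, F, g, h⟩ := exists_compactProfile k hk
  have h1 : ((k + 1 : ℕ) : ℝ) - 1 = k := by push_cast; ring
  have h2 : ((k + 1 : ℕ) : ℝ) + 1 = k + 2 := by push_cast; ring
  rw [h1, h2, Nat.add_sub_cancel]
  exact ⟨F, L, h.length_pos, h.isRadialProfile, fun r _ => h.nonneg r, h.antitone.antitoneOn _,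
    h.one_lt, h.closure_support, h.contDiffOn_two, fun r hr => h.classical hr, h.isEquivalent hk,
    fun T => ⟨h.isRadialMAFlow hk T, h.radialBlowUpSet_eq hk T⟩⟩
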